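/- Let $X$ be a real random variable, let $X_1,X_2,\dots$ be independent random variables with the same law as $X$, and put $\Pi'_n=X_1X_2\cdots X_n$ for $n\ge 1$. Assume that \begin{itemize} \item there is $\alpha>0$ with $\mathbb E[|X|^\alpha]=1$ and $\mathbb E\big[|X|^\alpha\log|X|\big]<\infty$ (where $0^\alpha\log 0:=0$); \item $\mathbb P(Xx+1=x)<1$ for every $x\in\mathbb R$; \item $\mathbb P(X<0)>0$. \end{itemize} Call the conditional law of $\log|X|$ given $\{X\ne 0\}$ arithmetic if its support is contained in $a\mathbb Z$ for some real $a\neq 0$, and non-arithmetic otherwise. (i) If the conditional law of $\log|X|$ given $\{X\neq 0\}$ is non-arithmetic, then there is a constant $c>0$ such that $$\lim_{x\to\infty}x^\alpha\,\mathbb P\Big(\max_{n\ge1}\Pi'_n>x\Big)=c .$$ (ii) If the conditional law of $\log|X|$ given $\{X\neq 0\}$ is arithmetic and $\mathbb P(|X|=1)<1$, then there are constants $0<c<c'<\infty$ such that, for all sufficiently large $x$, $$x^\alpha\,\mathbb P\Big(\max_{n\ge1}\Pi'_n>x\Big)\in[c,c'] .$$ Here $\max_{n\ge 1}\Pi'_n$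 is understood as the supremum in $[-\infty,\infty]$. -/

import Mathlib

open MeasureTheory ProbabilityTheory Filter Topology

/-- A law `ν` on the real line is arithmetic if its topological support is contained in the lattice
`a ℤ` for some nonzero real `a`; it is non-arithmetic otherwise. -/
def IsArithmetic (ν : Measure ℝ) : Prop :=
  ∃ a : ℝ, a ≠ 0 ∧ ν.support ⊆ (AddSubgroup.zmultiples a : Set ℝ)

/-- The conditional law of `log |X|` given the event `X ≠ 0`. -/
noncomputable def condLogLaw {Ω : Type*} [MeasurableSpace Ω] (P : Measure Ω) (X : Ω → ℝ) :
    Measure ℝ :=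
  (P[|{ω | X ω ≠ 0}]).map (fun ω => Real.log |X ω|)

/-- The product of the first `n` members of the sequence; with `Xs i` in the role of the
`(i+1)`-st factor this is `X_1 ⋯ X_n`. -/
def partialProd {Ω : Type*} (Xs : ℕ → Ω → ℝ) (n : ℕ) (ω : Ω) : ℝ :=
  ∏ i ∈ Finset.range n, Xs i ω

/-- The maximum (supremum) over `n ≥ 1` of the partial products, as an extended real number. -/
noncomputable def maxProd {Ω : Type*} (Xs : ℕ → Ω → ℝ) (ω : Ω) : EReal :=
  ⨆ n : ℕ, ⨆ _ : 1 ≤ n, (partialProd Xs n ω : EReal)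

/-!
The maximum is studied through the function `G y = |y| ^ α * u y` on the nonzero reals, where `u y`
is the probability that some partial product `Π n`, `n ≥ 0`, satisfies `Π n / y > 1`, that is, lies
beyond `y` on the same side of the origin. For `x ≥ 1` the quantity of interest is `G x`.

Conditioning on the first factor shows that `G` is harmonic off `(0, 1)` for the multiplicative
random walk whose increments have the law `ν` of `X` tilted by `|x| ^ α`. On the logarithmic scale
this walk has finite mean; by strict positivity of relative entropy the mean is positive unless
`|X| = 1` almost surely (`integral_log_tiltedLaw_pos`). Summed over the two signs, `G` becomes a
function `H t = G (e ^ t) + G (- e ^ t)` of one real variable which is harmonic on `[0, ∞)` for the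
walk with increment `ξ = log |x|`, and the flux `E ∫_{t - ξ}^t H` is then constant in `t ≥ 0`
(`renewalFlux_sub`).

*Lower bound.* The flux vanishes at `-∞`, never decreases, and increases strictly just below `0`,
since with positive probability the walk starting at `1` makes a large step towards the origin and
stays close to it. Hence the flux is bounded below by a positive constant on `[0, ∞)`, so that `H`
cannot be small on a long window. As `t ↦ e ^ (- α t) G (± e ^ t)` is nonincreasing and negative
factors have positive probability, this bounds `G` below near `+∞`
(`IsRescaledTail.exists_pos_le`). The upper bound `G ≤ 1` is a Markov-type inequality.

*Convergence.* After a logarithmic smoothing, `G` becomes a bounded Lipschitz function `K` of the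
logarithm. Let `K` approach its upper limit `L` along a sequence going to infinity. By harmonicity
it also approaches `L` along the sequence divided by any point of the support of `ν`, and hence by
any product of such points. In the non-arithmetic case these products are asymptotically dense, and
a negative point of the support reaches both signs, so there are arbitrarily long windows on which
`K` is close to `L`. The flux therefore equals `2 L E ξ`. The same argument for `- K` computes the
lower limit from the same flux, so the two coincide
(`IsLogLipschitzHarmonic.exists_tendsto_cobounded`). Letting the smoothing window shrink gives the
convergence of `G` (`IsRescaledTail.exists_tendsto_atTop`), and the lower bound shows that the limit
is positive.
-/

/-! ### Asymptotic density and the flux of a random walk -/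

/-- If the group generated by a set `S` of reals is dense and `S` has a positive element, then the
additive monoid generated by `S` is asymptotically dense at `+∞`. -/
lemma exists_mem_addSubmonoid_closure_near {S : Set ℝ} (hpos : ∃ x ∈ S, 0 < x)
    (hdense : Dense (AddSubgroup.closure S : Set ℝ)) {η : ℝ} (hη : 0 < η) :
    ∃ T : ℝ, ∀ y ≥ T, ∃ s ∈ AddSubmonoid.closure S, |s - y| < η := by
  obtain ⟨p, hpS, hp⟩ := hpos
  set M := AddSubmonoid.closure S with hM
  have hpM : p ∈ M := AddSubmonoid.subset_closure hpS
  have hdiff : ∀ g ∈ AddSubgroup.closure S, ∃ a ∈ M, ∃ b ∈ M, g = a - b := by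
    intro g hg
    induction hg using AddSubgroup.closure_induction with
    | mem x hx => exact ⟨x, AddSubmonoid.subset_closure hx, 0, M.zero_mem, by simp⟩
    | zero => exact ⟨0, M.zero_mem, 0, M.zero_mem, by simp⟩
    | add x y _ _ hx hy =>
      obtain ⟨a, ha, b, hb, rfl⟩ := hx
      obtain ⟨a', ha', b', hb', rfl⟩ := hy
      exact ⟨a + a', M.add_mem ha ha', b + b', M.add_mem hb hb', by ring⟩
    | neg x _ hx =>
      obtain ⟨a, ha, b, hb, rfl⟩ := hx
      exact ⟨b, hb, a, ha, by ring⟩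
  obtain ⟨g, hg, hg0, hgη⟩ := hdense.exists_between hη
  obtain ⟨a₀, ha₀, b₀, hb₀, rfl⟩ := hdiff g hg
  obtain ⟨N, hN⟩ := exists_nat_gt (-b₀ / p)
  have hNp : -b₀ < N * p := by rwa [div_lt_iff₀ hp] at hN
  -- Adding a multiple of `p` to both elements makes the smaller one positive.
  obtain ⟨a, b, ha, hb, hb0, hab0, habη⟩ : ∃ a b, a ∈ M ∧ b ∈ M ∧ 0 < b ∧
      0 < a - b ∧ a - b < η := by
    refine ⟨a₀ + N • p, b₀ + N • p, M.add_mem ha₀ (M.nsmul_mem hpM N),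
      M.add_mem hb₀ (M.nsmul_mem hpM N), ?_, ?_, ?_⟩ <;> simp only [nsmul_eq_mul] <;> linarith
  obtain ⟨n₀, hn₀⟩ := exists_nat_ge (b / (a - b))
  refine ⟨n₀ * b, fun y hy => ?_⟩
  have hy0 : 0 ≤ y := le_trans (by positivity) hy
  set n := ⌊y / b⌋₊ with hn
  have hn1 : n * b ≤ y := by
    have := Nat.floor_le (div_nonneg hy0 hb0.le)
    rwa [le_div_iff₀ hb0] at this
  have hn2 : y < (n + 1) * b := by
    have := Nat.lt_floor_add_one (y / b)
    rwa [div_lt_iff₀ hb0] at this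
  have hnn : n₀ ≤ n := Nat.le_floor (by rwa [le_div_iff₀ hb0])
  have hr0 : 0 ≤ (y - n * b) / (a - b) := div_nonneg (by linarith) hab0.le
  set j := ⌊(y - n * b) / (a - b)⌋₊ with hj
  have hj1 : j * (a - b) ≤ y - n * b := by
    have := Nat.floor_le hr0
    rwa [le_div_iff₀ hab0] at this
  have hj2 : y - n * b < (j + 1) * (a - b) := by
    have := Nat.lt_floor_add_one ((y - n * b) / (a - b))
    rwa [div_lt_iff₀ hab0] at this
  have hjn : j ≤ n := by
    have h1 : (j : ℝ) ≤ b / (a - b) := by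
      rw [le_div_iff₀ hab0]; linarith
    have h2 : (j : ℝ) ≤ (n₀ : ℝ) := h1.trans hn₀
    exact (Nat.cast_le.mp h2).trans hnn
  refine ⟨(n - j) • b + j • a, M.add_mem (M.nsmul_mem hb _) (M.nsmul_mem ha _), ?_⟩
  simp only [nsmul_eq_mul, Nat.cast_sub hjn]
  rw [abs_lt]
  constructor <;> nlinarith

/-- For a random walk with increment `ξ` (under `ν`) and a function `H` on the line, the quantity
`E ∫_{t - ξ}^t H`. It does not depend on `t` as long as `H` is harmonic for the walk. -/
noncomputable def renewalFlux {E : Type*} [MeasurableSpace E] (ν : Measure E) (ξ : E → ℝ)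
    (H : ℝ → ℝ) (t : ℝ) : ℝ :=
  ∫ x, (∫ r in (-ξ x)..0, H (t + r)) ∂ν

lemma abs_fluxIntegrand_le {E : Type*} {ξ : E → ℝ} {H : ℝ → ℝ} {B : ℝ} (hB : ∀ t, |H t| ≤ B)
    (t : ℝ) (x : E) : |∫ r in (-ξ x)..0, H (t + r)| ≤ B * |ξ x| := by
  have := intervalIntegral.norm_integral_le_of_norm_le_const (a := -ξ x) (b := 0)
    (f := fun r => H (t + r)) (C := B) fun r _ => by simpa using hB (t + r)
  simpa using this

section Flux

variable {E : Type*} [MeasurableSpace E] {ν : Measure E} {ξ : E → ℝ} {H : ℝ → ℝ} {B : ℝ}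

lemma intervalIntegrable_of_measurable_of_bounded (hH : Measurable H) (hB : ∀ t, |H t| ≤ B)
    (a b : ℝ) : IntervalIntegrable H volume a b :=
  (intervalIntegrable_const (c := B)).mono_fun' hH.aestronglyMeasurable
    (Eventually.of_forall fun t => by simpa using hB t)

lemma measurable_fluxIntegrand (hξ : Measurable ξ) (hH : Measurable H) (hB : ∀ t, |H t| ≤ B)
    (t : ℝ) : Measurable fun x => ∫ r in (-ξ x)..0, H (t + r) := by
  have h1 : Continuous fun y : ℝ => ∫ r in (0 : ℝ)..y, H (t + r) :=
    intervalIntegral.continuous_primitive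
      (fun a b => intervalIntegrable_of_measurable_of_bounded
        (hH.comp (measurable_const_add t)) (fun r => hB _) a b) 0
  have h2 : (fun x => ∫ r in (-ξ x)..0, H (t + r)) =
      fun x => -∫ r in (0 : ℝ)..(-ξ x), H (t + r) :=
    funext fun x => intervalIntegral.integral_symm _ _
  rw [h2]
  exact (h1.measurable.comp hξ.neg).neg

lemma integrable_fluxIntegrand (hξ : Measurable ξ) (hξi : Integrable ξ ν) (hH : Measurable H)
    (hB : ∀ t, |H t| ≤ B) (t : ℝ) : Integrable (fun x => ∫ r in (-ξ x)..0, H (t + r)) ν :=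
  (hξi.abs.const_mul B).mono' (measurable_fluxIntegrand hξ hH hB t).aestronglyMeasurable
    (Eventually.of_forall fun x => by simpa using abs_fluxIntegrand_le hB t x)

/-- The flux varies according to the defect of harmonicity of `H`. -/
lemma renewalFlux_sub [IsProbabilityMeasure ν] (hξ : Measurable ξ) (hξi : Integrable ξ ν)
    (hH : Measurable H) (hB : ∀ t, |H t| ≤ B) (a b : ℝ) :
    renewalFlux ν ξ H b - renewalFlux ν ξ H a = ∫ s in a..b, (H s - ∫ x, H (s - ξ x) ∂ν) := by
  have hint : ∀ c d : ℝ, IntervalIntegrable H volume c d :=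
    intervalIntegrable_of_measurable_of_bounded hH hB
  have hshift : ∀ c, Measurable fun s => H (s - c) := fun c => hH.comp (measurable_sub_const c)
  have hmeas : Measurable fun p : ℝ × E => H (p.1 - ξ p.2) :=
    hH.comp (measurable_fst.sub (hξ.comp measurable_snd))
  have hinner : Measurable fun s => ∫ x, H (s - ξ x) ∂ν :=
    (hmeas.stronglyMeasurable.integral_prod_right' (ν := ν)).measurable
  have hinnerB : ∀ s, |∫ x, H (s - ξ x) ∂ν| ≤ B := fun s => by
    have := norm_integral_le_of_norm_le_const (μ := ν) (f := fun x => H (s - ξ x)) (C := B)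
      (Eventually.of_forall fun x => by simpa using hB _)
    simpa using this
  have hkey : ∀ x, (∫ r in (-ξ x)..0, H (b + r)) - (∫ r in (-ξ x)..0, H (a + r)) =
      (∫ s in a..b, H s) - ∫ s in a..b, H (s - ξ x) := by
    intro x
    rw [intervalIntegral.integral_comp_add_left (fun s => H s),
      intervalIntegral.integral_comp_add_left (fun s => H s),
      intervalIntegral.integral_comp_sub_right (fun s => H s)]
    simp only [add_zero, ← sub_eq_add_neg]
    rw [← intervalIntegral.integral_add_adjacent_intervals (hint (b - ξ x) a) (hint a b),
      ← intervalIntegral.integral_add_adjacent_intervals (hint (a - ξ x) (b - ξ x))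
        (hint (b - ξ x) a)]
    ring
  unfold renewalFlux
  rw [← integral_sub (integrable_fluxIntegrand hξ hξi hH hB b)
    (integrable_fluxIntegrand hξ hξi hH hB a)]
  simp_rw [hkey]
  have : IsFiniteMeasure (volume.restrict (Set.uIoc a b)) := ⟨by simp [Set.uIoc]⟩
  have hprod : Integrable (Function.uncurry fun (s : ℝ) (x : E) => H (s - ξ x))
      ((volume.restrict (Set.uIoc a b)).prod ν) := by
    refine (integrable_const B).mono' hmeas.aestronglyMeasurable
      (Eventually.of_forall fun p => ?_)
    rw [Real.norm_eq_abs]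
    exact hB (p.1 - ξ p.2)
  have hsec : Integrable (fun x => ∫ s in a..b, H (s - ξ x)) ν := by
    simp_rw [intervalIntegral.intervalIntegral_eq_integral_uIoc]
    exact hprod.integral_prod_right.smul (if a ≤ b then (1 : ℝ) else -1)
  rw [integral_sub (integrable_const _) hsec, ← intervalIntegral_integral_swap hprod,
    intervalIntegral.integral_sub (hint a b)
      (intervalIntegrable_of_measurable_of_bounded hinner hinnerB a b)]
  simp

/-- Along times at which all translates of `H` converge to the constant `ℓ`, the flux converges to
`ℓ` times the mean of the increment. -/
lemma tendsto_renewalFlux {ι : Type*} {l : Filter ι} [l.IsCountablyGenerated]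
    (hξ : Measurable ξ) (hξi : Integrable ξ ν)
    (hH : Measurable H) (hB : ∀ t, |H t| ≤ B) {τ : ι → ℝ} {ℓ : ℝ}
    (hlim : ∀ r, Tendsto (fun i => H (τ i + r)) l (𝓝 ℓ)) :
    Tendsto (fun i => renewalFlux ν ξ H (τ i)) l (𝓝 (ℓ * ∫ x, ξ x ∂ν)) := by
  rw [← integral_const_mul]
  refine tendsto_integral_filter_of_dominated_convergence (fun x => B * |ξ x|)
    (Eventually.of_forall fun i => (measurable_fluxIntegrand hξ hH hB _).aestronglyMeasurable)
    (Eventually.of_forall fun i => Eventually.of_forall fun x => by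
      simpa using abs_fluxIntegrand_le hB (τ i) x) (hξi.abs.const_mul B)
    (Eventually.of_forall fun x => ?_)
  have h1 : ℓ * ξ x = ∫ _ in (-ξ x)..0, ℓ := by simp [mul_comm]
  rw [h1]
  refine intervalIntegral.tendsto_integral_filter_of_dominated_convergence (fun _ => B)
    (Eventually.of_forall fun i => (hH.comp (measurable_const_add _)).aestronglyMeasurable)
    (Eventually.of_forall fun i => Eventually.of_forall fun r _ => by simpa using hB _)
    intervalIntegrable_const (Eventually.of_forall fun r _ => hlim r)

end Flux

/-! ### Harmonic functions of a multiplicative random walk -/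

/-- The sum of the values of `K` at the two points `± e ^ t`. -/
noncomputable def signSum (K : ℝ → ℝ) (t : ℝ) : ℝ := K (Real.exp t) + K (-Real.exp t)

lemma measurable_log_abs : Measurable fun x : ℝ => Real.log |x| :=
  Real.measurable_log.comp measurable_id.abs

lemma measurable_signSum {K : ℝ → ℝ} (hK : Measurable K) : Measurable (signSum K) :=
  (hK.comp Real.measurable_exp).add (hK.comp Real.measurable_exp.neg)

lemma abs_signSum_le {K : ℝ → ℝ} {B : ℝ} (hB : ∀ y, |K y| ≤ B) (t : ℝ) :
    |signSum K t| ≤ 2 * B :=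
  (abs_add_le _ _).trans (by linarith [hB (Real.exp t), hB (-Real.exp t)])

/-- Dividing both points `± e ^ t` by `x` amounts, up to a permutation, to translating `t`. -/
lemma signSum_sub_log_abs (K : ℝ → ℝ) (t : ℝ) {x : ℝ} (hx : x ≠ 0) :
    signSum K (t - Real.log |x|) = K (Real.exp t / x) + K (-Real.exp t / x) := by
  unfold signSum
  rw [Real.exp_sub, Real.exp_log (abs_pos.mpr hx)]
  rcases lt_or_gt_of_ne hx with h | h
  · rw [abs_of_neg h, div_neg, neg_neg, neg_div, add_comm]
  · rw [abs_of_pos h, neg_div]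

lemma integrable_comp_div {ν : Measure ℝ} [IsFiniteMeasure ν] {K : ℝ → ℝ} {B : ℝ}
    (hK : Measurable K) (hB : ∀ y, |K y| ≤ B) (y : ℝ) : Integrable (fun x => K (y / x)) ν :=
  (integrable_const B).mono' (hK.comp (measurable_const.div measurable_id)).aestronglyMeasurable
    (Eventually.of_forall fun x => by simpa using hB _)

lemma integral_signSum_sub_log_abs {ν : Measure ℝ} [IsFiniteMeasure ν] (h0 : ν {0} = 0)
    {K : ℝ → ℝ} {B : ℝ} (hK : Measurable K) (hB : ∀ y, |K y| ≤ B) (t : ℝ) :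
    ∫ x, signSum K (t - Real.log |x|) ∂ν =
      (∫ x, K (Real.exp t / x) ∂ν) + ∫ x, K (-Real.exp t / x) ∂ν := by
  rw [← integral_add (integrable_comp_div hK hB _) (integrable_comp_div hK hB _)]
  refine integral_congr_ae ?_
  have h : ∀ᵐ x ∂ν, x ≠ 0 := by rw [ae_iff]; simpa using h0
  filter_upwards [h] with x hx using signSum_sub_log_abs K t hx

lemma tendsto_div_const_cobounded {y : ℕ → ℝ} (hy : Tendsto y atTop (Bornology.cobounded ℝ))
    {x : ℝ} (hx : x ≠ 0) : Tendsto (fun n => y n / x) atTop (Bornology.cobounded ℝ) := by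
  rw [← tendsto_norm_atTop_iff_cobounded] at hy ⊢
  simp_rw [norm_div]
  exact hy.atTop_div_const (norm_pos_iff.mpr hx)

lemma exists_pos_mul_lt_half {C ε : ℝ} (hC : 0 ≤ C) (hε : 0 < ε) : ∃ δ > 0, C * δ < ε / 2 := by
  refine ⟨ε / (2 * (C + 1)), by positivity, ?_⟩
  rw [mul_div_assoc', div_lt_div_iff₀ (by positivity) (by positivity)]
  nlinarith

/-- A bounded function on the line, Lipschitz in the logarithm of its argument, and harmonic far
from the origin for the multiplicative random walk with increment law `ν`. -/
structure IsLogLipschitzHarmonic (ν : Measure ℝ) (K : ℝ → ℝ) (B C R : ℝ) : Prop where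
  measurable : Measurable K
  bounded : ∀ y, |K y| ≤ B
  lipschitz : ∀ y r, |K (y * Real.exp r) - K y| ≤ C * |r|
  harmonic : ∀ y, R ≤ |y| → K y = ∫ x, K (y / x) ∂ν

namespace IsLogLipschitzHarmonic

variable {ν : Measure ℝ} {K : ℝ → ℝ} {B C R : ℝ}

lemma neg (h : IsLogLipschitzHarmonic ν K B C R) :
    IsLogLipschitzHarmonic ν (fun y => -K y) B C R where
  measurable := h.measurable.neg
  bounded y := by simpa using h.bounded y
  lipschitz y r := by
    have := h.lipschitz y r
    rwa [← abs_neg, show -(K (y * Real.exp r) - K y) = -K (y * Real.exp r) - -K y by ring] at this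
  harmonic y hy := by rw [integral_neg, h.harmonic y hy]

lemma nonneg_const (h : IsLogLipschitzHarmonic ν K B C R) : 0 ≤ C := by
  simpa using (abs_nonneg _).trans (h.lipschitz 1 1)

/-- The flux of a harmonic function is eventually constant. -/
lemma renewalFlux_eq [IsProbabilityMeasure ν] (h : IsLogLipschitzHarmonic ν K B C R)
    (h0 : ν {0} = 0) (hi : Integrable (fun x => Real.log |x|) ν) {a b : ℝ}
    (ha : R ≤ Real.exp a) (hb : R ≤ Real.exp b) :
    renewalFlux ν (fun x => Real.log |x|) (signSum K) b =
      renewalFlux ν (fun x => Real.log |x|) (signSum K) a := by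
  rw [← sub_eq_zero, renewalFlux_sub measurable_log_abs hi (measurable_signSum h.measurable)
    (abs_signSum_le h.bounded)]
  refine intervalIntegral.integral_zero_ae (Eventually.of_forall fun s hs => ?_)
  have hs' : R ≤ Real.exp s := by
    rcases Set.mem_uIoc.mp hs with h | h
    · exact ha.trans (Real.exp_le_exp.mpr h.1.le)
    · exact hb.trans (Real.exp_le_exp.mpr h.1.le)
  rw [integral_signSum_sub_log_abs h0 h.measurable h.bounded, signSum,
    h.harmonic (Real.exp s) (by simpa using hs'),
    h.harmonic (-Real.exp s) (by simpa using hs'), sub_self]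

/-- If a harmonic function approaches its upper limit `L` along a sequence of points, then it
also does so along the sequence divided by any point of the support of the increment law. -/
lemma tendsto_div_of_mem_support [IsProbabilityMeasure ν] (h : IsLogLipschitzHarmonic ν K B C R)
    (h0 : ν {0} = 0) {L : ℝ} (hup : ∀ ε > 0, ∀ᶠ y in Bornology.cobounded ℝ, K y < L + ε)
    {y : ℕ → ℝ} (hy : Tendsto y atTop (Bornology.cobounded ℝ))
    (hKy : Tendsto (fun n => K (y n)) atTop (𝓝 L)) {x : ℝ} (hx : x ∈ ν.support) (hx0 : x ≠ 0) :
    Tendsto (fun n => K (y n / x)) atTop (𝓝 L) := by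
  have hae : ∀ᵐ x ∂ν, x ≠ 0 := by rw [ae_iff]; simpa using h0
  have hmaxB : ∀ z, |max (K z) L| ≤ B + |L| := fun z => by
    have h1 := abs_le.mp (h.bounded z)
    have h2 := neg_abs_le L
    have h3 := le_abs_self L
    rw [abs_le]
    refine ⟨le_max_of_le_left (by linarith [abs_nonneg L]), max_le (by linarith [abs_nonneg L]) ?_⟩
    linarith [(abs_nonneg _).trans (h.bounded z)]
  have hmaxm : Measurable fun z => max (K z) L := h.measurable.max measurable_const
  have hmax : Tendsto (fun n => ∫ x, max (K (y n / x)) L ∂ν) atTop (𝓝 L) := by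
    have h1 : L = ∫ _, L ∂ν := by simp
    nth_rewrite 2 [h1]
    refine tendsto_integral_of_dominated_convergence (fun _ => B + |L|)
      (fun n => (integrable_comp_div hmaxm hmaxB _).aestronglyMeasurable) (integrable_const _)
      (fun n => Eventually.of_forall fun x => by simpa using hmaxB _) ?_
    filter_upwards [hae] with x hx
    rw [Metric.tendsto_nhds]
    intro ε hε
    filter_upwards [(tendsto_div_const_cobounded hy hx).eventually (hup ε hε)] with n hn
    rw [Real.dist_eq, abs_lt]
    exact ⟨by linarith [le_max_right (K (y n / x)) L],
      by linarith [max_lt hn (by linarith : L < L + ε)]⟩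
  have hdiff : Tendsto (fun n => ∫ x, (max (K (y n / x)) L - K (y n / x)) ∂ν) atTop (𝓝 0) := by
    have h1 := hmax.sub hKy
    rw [sub_self] at h1
    refine h1.congr' ?_
    rw [← tendsto_norm_atTop_iff_cobounded] at hy
    filter_upwards [hy.eventually_ge_atTop R] with n hn
    rw [h.harmonic (y n) hn, ← integral_sub (integrable_comp_div hmaxm hmaxB _)
      (integrable_comp_div h.measurable h.bounded _)]
  rw [Metric.tendsto_nhds]
  intro ε hε
  have hC := h.nonneg_const
  obtain ⟨δ, hδ, hCδ⟩ : ∃ δ > 0, C * δ < ε / 2 := exists_pos_mul_lt_half hC hε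
  -- A neighbourhood of `x` on which the Lipschitz bound controls the values of `K (y n / ·)`.
  set U : Set ℝ := {z | 0 < z / x ∧ |Real.log (z / x)| < δ} with hU
  have hUx : U ∈ 𝓝 x := by
    have hc : ContinuousAt (fun z : ℝ => z / x) x := continuousAt_id.div_const x
    have hc' : ContinuousAt (fun z : ℝ => |Real.log (z / x)|) x :=
      (hc.log (by simp [hx0])).abs
    refine Filter.inter_mem (hc.eventually (lt_mem_nhds (by simp [hx0])))
      (hc'.eventually (gt_mem_nhds (by simpa [hx0] using hδ)))
  have hpos : 0 < ν.real U := by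
    have := (Measure.mem_support_iff_forall x).mp hx U hUx
    exact ENNReal.toReal_pos this.ne' (measure_ne_top _ _)
  have hUm : MeasurableSet U := by
    have h1 : Measurable fun z : ℝ => z / x := measurable_id.div_const x
    exact (measurableSet_lt measurable_const h1).inter
      (measurableSet_lt (Real.measurable_log.comp h1).abs measurable_const)
  have hlow : ∀ n, ν.real U * (L - K (y n / x) - C * δ) ≤
      ∫ z, (max (K (y n / z)) L - K (y n / z)) ∂ν := by
    intro n
    have hint : Integrable (fun z => max (K (y n / z)) L - K (y n / z)) ν :=
      (integrable_comp_div hmaxm hmaxB _).sub (integrable_comp_div h.measurable h.bounded _)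
    calc ν.real U * (L - K (y n / x) - C * δ) = ∫ z in U, (L - K (y n / x) - C * δ) ∂ν := by
          simp
      _ ≤ ∫ z in U, (max (K (y n / z)) L - K (y n / z)) ∂ν := by
          refine setIntegral_mono_on (integrable_const _) hint.integrableOn hUm fun z hz => ?_
          have hz0 : z ≠ 0 := by
            rintro rfl
            simp [hU] at hz
          have h1 : y n / z * Real.exp (Real.log (z / x)) = y n / x := by
            rw [Real.exp_log hz.1]
            field_simp
          have h2 := h.lipschitz (y n / z) (Real.log (z / x))
          rw [h1] at h2
          have h3 : C * |Real.log (z / x)| ≤ C * δ := mul_le_mul_of_nonneg_left hz.2.le hC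
          have h4 := (abs_le.mp (h2.trans h3)).1
          linarith [le_max_right (K (y n / z)) L]
      _ ≤ _ := setIntegral_le_integral hint
          (Eventually.of_forall fun z => sub_nonneg.mpr (le_max_left _ _))
  filter_upwards [(tendsto_div_const_cobounded hy hx0).eventually (hup ε hε),
    hdiff.eventually (gt_mem_nhds (show 0 < ν.real U * (ε / 2) by positivity))] with n hn1 hn2
  have h1 := lt_of_mul_lt_mul_left ((hlow n).trans_lt hn2) hpos.le
  rw [Real.dist_eq, abs_lt]
  constructor <;> linarith

end IsLogLipschitzHarmonic

/-! ### Convergence of harmonic functions -/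

/-- The logarithms of the absolute values of the nonzero points of the support of `ν`. -/
def logSupport (ν : Measure ℝ) : Set ℝ := {t | ∃ x ∈ ν.support, x ≠ 0 ∧ t = Real.log |x|}

lemma exists_mem_logSupport_pos {ν : Measure ℝ} (h0 : ν {0} = 0)
    (hm : 0 < ∫ x, Real.log |x| ∂ν) : ∃ t ∈ logSupport ν, 0 < t := by
  by_contra! hcon
  refine hm.not_ge (integral_nonpos_of_ae ?_)
  have hae : ∀ᵐ x ∂ν, x ≠ 0 := by rw [ae_iff]; simpa using h0
  filter_upwards [hae, Measure.support_mem_ae (μ := ν)] with x hx hxs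
  exact hcon _ ⟨x, hxs, hx, rfl⟩

lemma dense_closure_two_mul_logSupport {ν : Measure ℝ}
    (hna : ¬∃ a : ℝ, a ≠ 0 ∧ logSupport ν ⊆ (AddSubgroup.zmultiples a : Set ℝ)) :
    Dense (AddSubgroup.closure ((fun t => 2 * t) '' logSupport ν) : Set ℝ) := by
  rcases AddSubgroup.dense_or_cyclic (AddSubgroup.closure ((fun t => 2 * t) '' logSupport ν))
    with h | ⟨a, ha⟩
  · exact h
  · exfalso
    rw [← AddSubgroup.zmultiples_eq_closure] at ha
    have hmem : ∀ t ∈ logSupport ν, ∃ k : ℤ, k * a = 2 * t := fun t ht => by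
      have h1 : 2 * t ∈ AddSubgroup.zmultiples a :=
        ha ▸ AddSubgroup.subset_closure (Set.mem_image_of_mem _ ht)
      obtain ⟨k, hk⟩ := AddSubgroup.mem_zmultiples_iff.mp h1
      exact ⟨k, by simpa using hk⟩
    by_cases ha0 : a = 0
    · refine hna ⟨1, one_ne_zero, fun t ht => ?_⟩
      obtain ⟨k, hk⟩ := hmem t ht
      have : t = 0 := by rw [ha0] at hk; linarith
      rw [this]
      exact AddSubgroup.zero_mem _
    · refine hna ⟨a / 2, by simpa using ha0, fun t ht => ?_⟩
      obtain ⟨k, hk⟩ := hmem t ht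
      exact AddSubgroup.mem_zmultiples_iff.mpr ⟨k, by simp only [zsmul_eq_mul]; linarith⟩

namespace IsLogLipschitzHarmonic

variable {ν : Measure ℝ} {K : ℝ → ℝ} {B C R : ℝ} [IsProbabilityMeasure ν]

/-- Sequences along which `K` approaches its upper limit may be multiplied by `e ^ (-s)` for every
`s` in the monoid generated by the doubled logarithms of the support; the doubling makes the sign
of the points irrelevant. -/
lemma tendsto_mul_exp_neg_of_mem_closure (h : IsLogLipschitzHarmonic ν K B C R)
    (h0 : ν {0} = 0) {L : ℝ} (hup : ∀ ε > 0, ∀ᶠ y in Bornology.cobounded ℝ, K y < L + ε)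
    {s : ℝ} (hs : s ∈ AddSubmonoid.closure ((fun t => 2 * t) '' logSupport ν)) :
    ∀ y : ℕ → ℝ, Tendsto y atTop (Bornology.cobounded ℝ) →
      Tendsto (fun n => K (y n)) atTop (𝓝 L) →
      Tendsto (fun n => y n * Real.exp (-s)) atTop (Bornology.cobounded ℝ) ∧
      Tendsto (fun n => K (y n * Real.exp (-s))) atTop (𝓝 L) := by
  induction hs using AddSubmonoid.closure_induction with
  | mem s hs =>
    intro y hy hKy
    obtain ⟨_, ⟨x, hx, hx0, rfl⟩, rfl⟩ := hs
    have heq : ∀ n, y n * Real.exp (-(2 * Real.log |x|)) = y n / x / x := fun n => by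
      rw [Real.exp_neg, two_mul, Real.exp_add, Real.exp_log (abs_pos.mpr hx0), abs_mul_abs_self,
        div_div, div_eq_mul_inv]
    simp only [heq]
    have h1 := tendsto_div_const_cobounded hy hx0
    have h2 := h.tendsto_div_of_mem_support h0 hup hy hKy hx hx0
    exact ⟨tendsto_div_const_cobounded h1 hx0, h.tendsto_div_of_mem_support h0 hup h1 h2 hx hx0⟩
  | zero =>
    intro y hy hKy
    simp only [neg_zero, Real.exp_zero, mul_one]
    exact ⟨hy, hKy⟩
  | add s t _ _ ihs iht =>
    intro y hy hKy
    obtain ⟨h1, h2⟩ := ihs y hy hKy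
    have heq : ∀ n, y n * Real.exp (-(s + t)) = y n * Real.exp (-s) * Real.exp (-t) := fun n => by
      rw [neg_add, Real.exp_add, mul_assoc]
    simp only [heq]
    exact iht _ h1 h2

/-- Far enough behind a sequence along which `K` approaches its upper limit `L`, the function `K`
is close to `L` at points of both signs. -/
lemma eventually_near_behind (h : IsLogLipschitzHarmonic ν K B C R)
    (h0 : ν {0} = 0) (hm : 0 < ∫ x, Real.log |x| ∂ν) (hneg : ν (Set.Iio 0) ≠ 0)
    (hna : ¬∃ a : ℝ, a ≠ 0 ∧ logSupport ν ⊆ (AddSubgroup.zmultiples a : Set ℝ))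
    {L : ℝ} (hup : ∀ ε > 0, ∀ᶠ y in Bornology.cobounded ℝ, K y < L + ε)
    {y : ℕ → ℝ} (hy : Tendsto y atTop (Bornology.cobounded ℝ))
    (hKy : Tendsto (fun n => K (y n)) atTop (𝓝 L)) {η : ℝ} (hη : 0 < η) :
    ∃ T : ℝ, ∀ t ≥ T, ∀ᶠ n in atTop,
      |K (y n * Real.exp (-t)) - L| ≤ η ∧ |K (-y n * Real.exp (-t)) - L| ≤ η := by
  have hC := h.nonneg_const
  obtain ⟨δ, hδ, hCδ⟩ : ∃ δ > 0, C * δ < η / 2 := exists_pos_mul_lt_half hC hη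
  have hS : ∃ t ∈ (fun t => 2 * t) '' logSupport ν, 0 < t := by
    obtain ⟨t, ht, htpos⟩ := exists_mem_logSupport_pos h0 hm
    exact ⟨2 * t, Set.mem_image_of_mem _ ht, by positivity⟩
  obtain ⟨T, hT⟩ := exists_mem_addSubmonoid_closure_near hS
    (dense_closure_two_mul_logSupport hna) hδ
  have hkey : ∀ y : ℕ → ℝ, Tendsto y atTop (Bornology.cobounded ℝ) →
      Tendsto (fun n => K (y n)) atTop (𝓝 L) → ∀ t ≥ T, ∀ᶠ n in atTop,
      |K (y n * Real.exp (-t)) - L| ≤ η := by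
    intro y hy hKy t ht
    obtain ⟨s, hs, hst⟩ := hT t ht
    have h1 := (h.tendsto_mul_exp_neg_of_mem_closure h0 hup hs y hy hKy).2
    filter_upwards [(Metric.tendsto_nhds.mp h1) (η / 2) (by positivity)] with n hn
    have h2 := h.lipschitz (y n * Real.exp (-s)) (s - t)
    rw [mul_assoc, ← Real.exp_add, show -s + (s - t) = -t by ring] at h2
    have h3 : C * |s - t| ≤ C * δ := mul_le_mul_of_nonneg_left hst.le hC
    rw [Real.dist_eq] at hn
    calc _ ≤ |K (y n * Real.exp (-t)) - K (y n * Real.exp (-s))| +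
          |K (y n * Real.exp (-s)) - L| := abs_sub_le _ _ _
      _ ≤ η := by linarith
  -- A negative point of the support exchanges the two signs.
  obtain ⟨x, hx, hxs⟩ : (Set.Iio (0 : ℝ) ∩ ν.support).Nonempty :=
    Measure.nonempty_inter_support_of_pos (pos_iff_ne_zero.mpr hneg)
  have hx0 : x < 0 := hx
  have hyx : Tendsto (fun n => y n / x) atTop (Bornology.cobounded ℝ) :=
    tendsto_div_const_cobounded hy hx0.ne
  have hKyx := h.tendsto_div_of_mem_support h0 hup hy hKy hxs hx0.ne
  refine ⟨max T (T + Real.log (-x)), fun t ht => ?_⟩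
  filter_upwards [hkey y hy hKy t ((le_max_left _ _).trans ht),
    hkey _ hyx hKyx (t - Real.log (-x))
      (by linarith [(le_max_right T (T + Real.log (-x))).trans ht])] with n hn1 hn2
  refine ⟨hn1, ?_⟩
  rw [show -(t - Real.log (-x)) = Real.log (-x) + -t by ring, Real.exp_add,
    Real.exp_log (neg_pos.mpr hx0)] at hn2
  rwa [show -y n * Real.exp (-t) = y n / x * (-x * Real.exp (-t)) by
    rw [← mul_assoc, mul_neg, div_mul_cancel₀ _ hx0.ne]]

/-- The previous statement, uniformly on bounded logarithmic windows. -/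
lemma exists_window_near (h : IsLogLipschitzHarmonic ν K B C R)
    (h0 : ν {0} = 0) (hm : 0 < ∫ x, Real.log |x| ∂ν) (hneg : ν (Set.Iio 0) ≠ 0)
    (hna : ¬∃ a : ℝ, a ≠ 0 ∧ logSupport ν ⊆ (AddSubgroup.zmultiples a : Set ℝ))
    {L : ℝ} (hup : ∀ ε > 0, ∀ᶠ y in Bornology.cobounded ℝ, K y < L + ε)
    {y : ℕ → ℝ} (hy : Tendsto y atTop (Bornology.cobounded ℝ))
    (hKy : Tendsto (fun n => K (y n)) atTop (𝓝 L)) {η : ℝ} (hη : 0 < η) (N : ℝ) :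
    ∃ τ ≥ N, ∀ s, |s| ≤ N →
      |K (Real.exp (τ + s)) - L| ≤ η ∧ |K (-Real.exp (τ + s)) - L| ≤ η := by
  have hC := h.nonneg_const
  obtain ⟨δ, hδ, hCδ⟩ : ∃ δ > 0, C * δ < η / 2 := exists_pos_mul_lt_half hC hη
  obtain ⟨T, hT⟩ := h.eventually_near_behind h0 hm hneg hna hup hy hKy (half_pos hη)
  obtain ⟨F, hFsub, hF, hcover⟩ :=
    (isCompact_Icc (a := T) (b := T + 2 * N)).finite_cover_balls hδ
  have hev := (eventually_all_finite hF).mpr fun t ht => hT t (hFsub ht).1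
  rw [← tendsto_norm_atTop_iff_cobounded] at hy
  obtain ⟨n, hn1, hn2⟩ := (hev.and (hy.eventually_ge_atTop (Real.exp (T + 2 * N)))).exists
  rw [Real.norm_eq_abs] at hn2
  have hn0 : 0 < |y n| := (Real.exp_pos _).trans_le hn2
  have hlog : T + 2 * N ≤ Real.log |y n| := (Real.le_log_iff_exp_le hn0).mpr hn2
  refine ⟨Real.log |y n| - (T + N), by linarith, fun s hs => ?_⟩
  have hs' := abs_le.mp hs
  obtain ⟨t, htF, ht⟩ : ∃ t ∈ F, |T + N - s - t| < δ := by
    have := hcover (show T + N - s ∈ Set.Icc T (T + 2 * N) from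
      ⟨by linarith, by linarith⟩)
    simpa only [Set.mem_iUnion, Metric.mem_ball, Real.dist_eq, exists_prop] using this
  have hlip : ∀ w, |K (w * Real.exp (-t)) - L| ≤ η / 2 →
      |K (w * Real.exp (-(T + N - s))) - L| ≤ η := by
    intro w hw
    have h2 := h.lipschitz (w * Real.exp (-t)) (-(T + N - s - t))
    rw [mul_assoc, ← Real.exp_add, show -t + -(T + N - s - t) = -(T + N - s) by ring, abs_neg]
      at h2
    have h3 : C * |T + N - s - t| ≤ C * δ := mul_le_mul_of_nonneg_left ht.le hC
    calc _ ≤ |K (w * Real.exp (-(T + N - s))) - K (w * Real.exp (-t))| +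
          |K (w * Real.exp (-t)) - L| := abs_sub_le _ _ _
      _ ≤ η := by linarith
  have h1 := hlip _ (hn1 t htF).1
  have h2 := hlip _ (hn1 t htF).2
  have hexp : Real.exp (Real.log |y n| - (T + N) + s) = |y n| * Real.exp (-(T + N - s)) := by
    rw [show Real.log |y n| - (T + N) + s = Real.log |y n| + -(T + N - s) by ring, Real.exp_add,
      Real.exp_log hn0]
  rw [hexp, ← neg_mul]
  rcases abs_choice (y n) with he | he <;> rw [he]
  · exact ⟨h1, h2⟩
  · exact ⟨h2, by rwa [neg_neg]⟩

/-- The upper limit of a harmonic function is determined by its flux. -/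
lemma two_mul_upperLimit_eq_renewalFlux (h : IsLogLipschitzHarmonic ν K B C R)
    (h0 : ν {0} = 0) (hi : Integrable (fun x => Real.log |x|) ν)
    (hm : 0 < ∫ x, Real.log |x| ∂ν) (hneg : ν (Set.Iio 0) ≠ 0)
    (hna : ¬∃ a : ℝ, a ≠ 0 ∧ logSupport ν ⊆ (AddSubgroup.zmultiples a : Set ℝ))
    {L : ℝ} (hup : ∀ ε > 0, ∀ᶠ y in Bornology.cobounded ℝ, K y < L + ε)
    (hfreq : ∀ ε > 0, ∃ᶠ y in Bornology.cobounded ℝ, L - ε < K y)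
    {t₀ : ℝ} (ht₀ : R ≤ Real.exp t₀) :
    2 * L * ∫ x, Real.log |x| ∂ν =
      renewalFlux ν (fun x => Real.log |x|) (signSum K) t₀ := by
  have hε : ∀ n : ℕ, (0 : ℝ) < 1 / (n + 1) := fun n => by positivity
  obtain ⟨y, hy, hKy⟩ : ∃ y : ℕ → ℝ, Tendsto y atTop (Bornology.cobounded ℝ) ∧
      Tendsto (fun n => K (y n)) atTop (𝓝 L) := by
    have hex : ∀ n : ℕ, ∃ y : ℝ, |K y - L| ≤ 1 / (n + 1) ∧ (n : ℝ) ≤ |y| := fun n => by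
      have h1 : ∀ᶠ y in Bornology.cobounded ℝ, (n : ℝ) ≤ ‖y‖ :=
        tendsto_norm_cobounded_atTop.eventually_ge_atTop _
      obtain ⟨y, hy1, hy2, hy3⟩ :=
        ((hfreq _ (hε n)).and_eventually ((hup _ (hε n)).and h1)).exists
      exact ⟨y, abs_le.mpr ⟨by linarith, by linarith⟩, hy3⟩
    choose y hy1 hy2 using hex
    refine ⟨y, ?_, ?_⟩
    · rw [← tendsto_norm_atTop_iff_cobounded]
      exact tendsto_atTop_mono hy2 tendsto_natCast_atTop_atTop
    · rw [tendsto_iff_norm_sub_tendsto_zero]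
      exact squeeze_zero (fun _ => norm_nonneg _) hy1 tendsto_one_div_add_atTop_nhds_zero_nat
  choose τ hτ hτK using fun n : ℕ =>
    h.exists_window_near h0 hm hneg hna hup hy hKy (hε n) (n : ℝ)
  have hlim : ∀ r, Tendsto (fun n => signSum K (τ n + r)) atTop (𝓝 (2 * L)) := by
    intro r
    have hev : ∀ᶠ n : ℕ in atTop, |r| ≤ n := tendsto_natCast_atTop_atTop.eventually_ge_atTop _
    rw [two_mul]
    refine Tendsto.add ?_ ?_ <;> rw [tendsto_iff_norm_sub_tendsto_zero]
    · exact squeeze_zero' (Eventually.of_forall fun _ => norm_nonneg _)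
        (hev.mono fun n hn => (hτK n r hn).1) tendsto_one_div_add_atTop_nhds_zero_nat
    · exact squeeze_zero' (Eventually.of_forall fun _ => norm_nonneg _)
        (hev.mono fun n hn => (hτK n r hn).2) tendsto_one_div_add_atTop_nhds_zero_nat
  have hflux := tendsto_renewalFlux measurable_log_abs hi (measurable_signSum h.measurable)
    (abs_signSum_le h.bounded) hlim
  refine tendsto_nhds_unique hflux (tendsto_const_nhds.congr' ?_)
  have hτtop : Tendsto τ atTop atTop := tendsto_atTop_mono hτ tendsto_natCast_atTop_atTop
  filter_upwards [hτtop.eventually_ge_atTop t₀] with n hn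
  exact (h.renewalFlux_eq h0 hi ht₀ (ht₀.trans (Real.exp_le_exp.mpr hn))).symm

/-- A bounded log-Lipschitz function that is harmonic far from the origin converges at infinity,
provided that the increment law has positive logarithmic drift, charges the negative half-line and
is non-arithmetic: both its upper and its lower limit are determined by its flux. -/
theorem exists_tendsto_cobounded (h : IsLogLipschitzHarmonic ν K B C R)
    (h0 : ν {0} = 0) (hi : Integrable (fun x => Real.log |x|) ν)
    (hm : 0 < ∫ x, Real.log |x| ∂ν) (hneg : ν (Set.Iio 0) ≠ 0)
    (hna : ¬∃ a : ℝ, a ≠ 0 ∧ logSupport ν ⊆ (AddSubgroup.zmultiples a : Set ℝ)) :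
    ∃ ℓ, Tendsto K (Bornology.cobounded ℝ) (𝓝 ℓ) := by
  have hbu : IsBoundedUnder (· ≤ ·) (Bornology.cobounded ℝ) K :=
    isBoundedUnder_of ⟨B, fun y => (abs_le.mp (h.bounded y)).2⟩
  have hbl : IsBoundedUnder (· ≥ ·) (Bornology.cobounded ℝ) K :=
    isBoundedUnder_of ⟨-B, fun y => (abs_le.mp (h.bounded y)).1⟩
  have ht₀ : R ≤ Real.exp (Real.log (max R 1)) := by
    rw [Real.exp_log (by positivity)]
    exact le_max_left _ _
  have hsup := h.two_mul_upperLimit_eq_renewalFlux h0 hi hm hneg hna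
    (L := limsup K (Bornology.cobounded ℝ))
    (fun ε hε => eventually_lt_of_limsup_lt (by linarith) hbu)
    (fun ε hε => frequently_lt_of_lt_limsup hbl.isCoboundedUnder_le (by linarith)) ht₀
  have hinf := h.neg.two_mul_upperLimit_eq_renewalFlux h0 hi hm hneg hna
    (L := -liminf K (Bornology.cobounded ℝ))
    (fun ε hε => (eventually_lt_of_lt_liminf
      (show liminf K (Bornology.cobounded ℝ) - ε < _ by linarith) hbl).mono
        fun y hy => by linarith)
    (fun ε hε => (frequently_lt_of_liminf_lt hbu.isCoboundedUnder_ge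
      (show _ < liminf K (Bornology.cobounded ℝ) + ε by linarith)).mono
        fun y hy => by linarith) ht₀
  have hflux : renewalFlux ν (fun x => Real.log |x|) (signSum fun y => -K y)
      (Real.log (max R 1)) =
      -renewalFlux ν (fun x => Real.log |x|) (signSum K) (Real.log (max R 1)) := by
    unfold renewalFlux
    rw [← integral_neg]
    congr 1 with x
    rw [← intervalIntegral.integral_neg]
    congr 1 with r
    unfold signSum
    ring
  rw [hflux, ← hsup] at hinf
  have heq : liminf K (Bornology.cobounded ℝ) = limsup K (Bornology.cobounded ℝ) := by
    have := mul_right_cancel₀ hm.ne' (hinf.trans (neg_mul _ _).symm)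
    linarith
  exact ⟨_, tendsto_of_liminf_eq_limsup heq rfl hbu hbl⟩

end IsLogLipschitzHarmonic

/-! ### Positivity of the rescaled tail -/

/-- The properties of the rescaled tail function `G y = |y| ^ α * P (∃ n ≥ 0, Π n / y > 1)` of the
multiplicative random walk `Π` on which the asymptotic analysis rests. Here `ν` is the law of the
factors, tilted by `|x| ^ α`; harmonicity fails only on `(0, 1)`, where the initial value `Π 0 = 1`
is already beyond `y`. -/
structure IsRescaledTail (ν : Measure ℝ) (α : ℝ) (G : ℝ → ℝ) : Prop where
  measurable : Measurable G
  nonneg : ∀ y, 0 ≤ G y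
  le_one : ∀ y, G y ≤ 1
  le_rpow : ∀ y, G y ≤ |y| ^ α
  regular : ∀ y s, 0 ≤ s → Real.exp (-(α * s)) * G y ≤ G (y * Real.exp (-s))
  harmonic : ∀ y, y ∉ Set.Ioo 0 1 → G y = ∫ x, G (y / x) ∂ν
  superharmonic : ∀ y, ∫ x, G (y / x) ∂ν ≤ G y
  gap : ∃ δ > 0, ∃ c > 0, ∀ t ∈ Set.Ioo (-δ) 0,
    c ≤ G (Real.exp t) - ∫ x, G (Real.exp t / x) ∂ν

namespace IsRescaledTail

variable {ν : Measure ℝ} {α : ℝ} {G : ℝ → ℝ}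

lemma abs_le_one (h : IsRescaledTail ν α G) (y : ℝ) : |G y| ≤ 1 :=
  abs_le.mpr ⟨by linarith [h.nonneg y], h.le_one y⟩

lemma abs_signSum_le_two (h : IsRescaledTail ν α G) (t : ℝ) : |signSum G t| ≤ 2 := by
  simpa using abs_signSum_le h.abs_le_one t

variable [IsProbabilityMeasure ν]

lemma renewalFlux_sub_eq (h : IsRescaledTail ν α G) (h0 : ν {0} = 0)
    (hi : Integrable (fun x => Real.log |x|) ν) (a b : ℝ) :
    renewalFlux ν (fun x => Real.log |x|) (signSum G) b -
      renewalFlux ν (fun x => Real.log |x|) (signSum G) a =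
      ∫ s in a..b, (G (Real.exp s) - ∫ x, G (Real.exp s / x) ∂ν) := by
  rw [renewalFlux_sub measurable_log_abs hi (measurable_signSum h.measurable)
    (abs_signSum_le h.abs_le_one)]
  congr 1 with s
  rw [integral_signSum_sub_log_abs h0 h.measurable h.abs_le_one, signSum,
    h.harmonic (-Real.exp s) (fun hs => by linarith [hs.1, Real.exp_pos s])]
  ring

lemma intervalIntegrable_defect (h : IsRescaledTail ν α G) (a b : ℝ) :
    IntervalIntegrable (fun s => G (Real.exp s) - ∫ x, G (Real.exp s / x) ∂ν) volume a b := by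
  have hm : Measurable fun p : ℝ × ℝ => G (Real.exp p.1 / p.2) :=
    h.measurable.comp ((Real.measurable_exp.comp measurable_fst).div measurable_snd)
  refine intervalIntegrable_of_measurable_of_bounded (B := 1)
    ((h.measurable.comp Real.measurable_exp).sub
      (hm.stronglyMeasurable.integral_prod_right' (ν := ν)).measurable) (fun s => ?_) a b
  have h1 : 0 ≤ ∫ x, G (Real.exp s / x) ∂ν := integral_nonneg fun x => h.nonneg _
  change |G (Real.exp s) - ∫ x, G (Real.exp s / x) ∂ν| ≤ 1
  rw [abs_of_nonneg (sub_nonneg.mpr (h.superharmonic _))]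
  linarith [h.le_one (Real.exp s)]

lemma renewalFlux_mono (h : IsRescaledTail ν α G) (h0 : ν {0} = 0)
    (hi : Integrable (fun x => Real.log |x|) ν) :
    Monotone (renewalFlux ν (fun x => Real.log |x|) (signSum G)) := fun a b hab => by
  rw [← sub_nonneg, h.renewalFlux_sub_eq h0 hi]
  exact intervalIntegral.integral_nonneg hab fun s _ => sub_nonneg.mpr (h.superharmonic _)

/-- The flux vanishes at `-∞`, is nondecreasing, and increases strictly just below `0`. -/
lemma exists_renewalFlux_ge (h : IsRescaledTail ν α G) (hα : 0 < α) (h0 : ν {0} = 0)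
    (hi : Integrable (fun x => Real.log |x|) ν) :
    ∃ c > 0, ∀ t ≥ 0, c ≤ renewalFlux ν (fun x => Real.log |x|) (signSum G) t := by
  obtain ⟨δ, hδ, c, hc, hgap⟩ := h.gap
  have hmono := h.renewalFlux_mono h0 hi
  have hlim : Tendsto (fun n : ℕ => renewalFlux ν (fun x => Real.log |x|) (signSum G) (-(n : ℝ)))
      atTop (𝓝 0) := by
    have h1 : ∀ r, Tendsto (fun n : ℕ => signSum G (-(n : ℝ) + r)) atTop (𝓝 0) := fun r => by
      have h2 : Tendsto (fun n : ℕ => 2 * Real.exp (α * (-(n : ℝ) + r))) atTop (𝓝 0) := by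
        rw [show (0 : ℝ) = 2 * 0 by simp]
        refine Tendsto.const_mul _ (Real.tendsto_exp_atBot.comp
          (Tendsto.const_mul_atBot hα (tendsto_atBot_add_const_right _ _ ?_)))
        exact tendsto_neg_atTop_atBot.comp tendsto_natCast_atTop_atTop
      refine squeeze_zero (fun n => add_nonneg (h.nonneg _) (h.nonneg _)) (fun n => ?_) h2
      have h3 := h.le_rpow (Real.exp (-(n : ℝ) + r))
      have h4 := h.le_rpow (-Real.exp (-(n : ℝ) + r))
      rw [abs_neg] at h4
      rw [abs_of_pos (Real.exp_pos _), ← Real.exp_mul, mul_comm] at h3 h4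
      unfold signSum
      linarith
    simpa using tendsto_renewalFlux measurable_log_abs hi (measurable_signSum h.measurable)
      h.abs_signSum_le_two h1
  have hδ0 : 0 ≤ renewalFlux ν (fun x => Real.log |x|) (signSum G) (-δ) := by
    refine le_of_tendsto hlim ?_
    filter_upwards [tendsto_natCast_atTop_atTop.eventually_ge_atTop δ] with n hn
    exact hmono (by linarith)
  refine ⟨δ * c, by positivity, fun t ht => le_trans ?_ (hmono ht)⟩
  have h1 : ∫ _ in (-δ)..0, c ≤
      ∫ s in (-δ)..0, (G (Real.exp s) - ∫ x, G (Real.exp s / x) ∂ν) :=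
    intervalIntegral.integral_mono_on_of_le_Ioo (by linarith) intervalIntegrable_const
      (h.intervalIntegrable_defect _ _) hgap
  rw [← h.renewalFlux_sub_eq h0 hi] at h1
  simp only [intervalIntegral.integral_const, zero_sub, neg_neg, smul_eq_mul] at h1
  linarith

/-- As the flux stays away from zero, every time window of a certain length contains a time at which
`G` is not small. -/
lemma exists_signSum_ge (h : IsRescaledTail ν α G) (hα : 0 < α) (h0 : ν {0} = 0)
    (hi : Integrable (fun x => Real.log |x|) ν) :
    ∃ ε > 0, ∃ T ≥ 0, ∀ t ≥ 0, ∃ v ∈ Set.Icc (t - T) t, ε ≤ signSum G v := by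
  obtain ⟨c, hc, hflux⟩ := h.exists_renewalFlux_ge hα h0 hi
  set ξ : ℝ → ℝ := fun x => Real.log |x| with hξ
  -- The contribution of large increments to the flux is negligible.
  obtain ⟨T, hT0, hT⟩ : ∃ T ≥ (0 : ℝ), ∫ x, {x | T < ξ x}.indicator (fun x => 2 * |ξ x|) x ∂ν
      < c / 2 := by
    have hlim : Tendsto (fun n : ℕ => ∫ x, {x | (n : ℝ) < ξ x}.indicator (fun x => 2 * |ξ x|) x ∂ν)
        atTop (𝓝 (∫ _, (0 : ℝ) ∂ν)) := by
      refine tendsto_integral_of_dominated_convergence (fun x => 2 * |ξ x|) (fun n => ?_)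
        (hi.abs.const_mul 2) (fun n => Eventually.of_forall fun x => ?_)
        (Eventually.of_forall fun x => ?_)
      · exact ((measurable_log_abs.abs.const_mul 2).indicator
          (measurableSet_lt measurable_const measurable_log_abs)).aestronglyMeasurable
      · refine (norm_indicator_le_norm_self _ _).trans ?_
        rw [Real.norm_eq_abs, abs_of_nonneg (by positivity)]
      · refine tendsto_const_nhds.congr' ?_
        filter_upwards [tendsto_natCast_atTop_atTop.eventually_ge_atTop (ξ x)] with n hn
        rw [Set.indicator_of_notMem (by simpa using hn)]
    rw [integral_zero] at hlim
    obtain ⟨n, hn⟩ := (hlim.eventually (gt_mem_nhds (half_pos hc))).exists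
    exact ⟨n, n.cast_nonneg, hn⟩
  have hI : 0 ≤ ∫ x, |ξ x| ∂ν := integral_nonneg fun x => abs_nonneg _
  set ε := c / (2 * ((∫ x, |ξ x| ∂ν) + 1)) with hε
  have hεpos : 0 < ε := by positivity
  refine ⟨ε, hεpos, T, hT0, fun t ht => ?_⟩
  by_contra! hcon
  have hle : ∀ x, (∫ r in (-ξ x)..0, signSum G (t + r)) ≤
      ε * |ξ x| + {x | T < ξ x}.indicator (fun x => 2 * |ξ x|) x := by
    intro x
    have hint : ∀ a b, IntervalIntegrable (fun r => signSum G (t + r)) volume a b :=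
      intervalIntegrable_of_measurable_of_bounded
        ((measurable_signSum h.measurable).comp (measurable_const_add t))
        fun r => h.abs_signSum_le_two _
    have hnn : ∀ v, 0 ≤ signSum G v := fun v => add_nonneg (h.nonneg _) (h.nonneg _)
    by_cases hx : T < ξ x
    · rw [Set.indicator_of_mem (show x ∈ {x | T < ξ x} from hx)]
      have h1 := abs_fluxIntegrand_le (ξ := ξ) h.abs_signSum_le_two t x
      have h2 : 0 ≤ ε * |ξ x| := by positivity
      linarith [le_abs_self (∫ r in (-ξ x)..0, signSum G (t + r))]
    · rw [Set.indicator_of_notMem (by simpa using hx), add_zero]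
      rw [not_lt] at hx
      rcases le_total (ξ x) 0 with hx0 | hx0
      · rw [intervalIntegral.integral_symm]
        have h1 : 0 ≤ ∫ r in (0 : ℝ)..(-ξ x), signSum G (t + r) :=
          intervalIntegral.integral_nonneg (by linarith) fun r _ => hnn _
        have h2 : 0 ≤ ε * |ξ x| := by positivity
        linarith
      · have h1 : (∫ r in (-ξ x)..0, signSum G (t + r)) ≤ ∫ r in (-ξ x)..0, ε :=
          intervalIntegral.integral_mono_on (by linarith) (hint _ _) intervalIntegrable_const
            fun r hr => (hcon (t + r) ⟨by linarith [hr.1], by linarith [hr.2]⟩).le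
        simp only [intervalIntegral.integral_const, smul_eq_mul] at h1
        rw [abs_of_nonneg hx0]
        linarith
  have hind : Integrable (fun x => {x | T < ξ x}.indicator (fun x => 2 * |ξ x|) x) ν :=
    (hi.abs.const_mul 2).indicator (measurableSet_lt measurable_const measurable_log_abs)
  have h1 : renewalFlux ν ξ (signSum G) t ≤
      ∫ x, (ε * |ξ x| + {x | T < ξ x}.indicator (fun x => 2 * |ξ x|) x) ∂ν :=
    integral_mono (integrable_fluxIntegrand measurable_log_abs hi
      (measurable_signSum h.measurable) h.abs_signSum_le_two t)
      ((hi.abs.const_mul ε).add hind) hle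
  rw [integral_add (hi.abs.const_mul ε) hind, integral_const_mul] at h1
  have h2 : ε * ∫ x, |ξ x| ∂ν ≤ c / 2 := by
    rw [hε, div_mul_eq_mul_div, div_le_div_iff₀ (by positivity) (by positivity)]
    nlinarith
  linarith [hflux t ht]

/-- The rescaled tail is bounded away from zero at `+∞`. A lower bound for the other sign is
transferred by a negative factor. -/
theorem exists_pos_le (h : IsRescaledTail ν α G) (hα : 0 < α) (h0 : ν {0} = 0)
    (hi : Integrable (fun x => Real.log |x|) ν) (hneg : ν (Set.Iio 0) ≠ 0) :
    ∃ c > 0, ∀ t ≥ 0, c ≤ G (Real.exp t) := by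
  obtain ⟨ε, hε, T, hT, hwin⟩ := h.exists_signSum_ge hα h0 hi
  have hreg : ∀ v w : ℝ, w ≤ v → ∀ σ : ℝ,
      Real.exp (-(α * (v - w))) * G (σ * Real.exp v) ≤ G (σ * Real.exp w) := by
    intro v w hwv σ
    have := h.regular (σ * Real.exp v) (v - w) (by linarith)
    rwa [mul_assoc σ, ← Real.exp_add, show v + -(v - w) = w by ring] at this
  obtain ⟨a, ha⟩ : ∃ a : ℕ, ν {x | x < 0 ∧ |(Real.log |x|)| ≤ a} ≠ 0 := by
    by_contra! hcon
    refine hneg (measure_mono_null (fun x hx => ?_) (measure_iUnion_null hcon))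
    obtain ⟨n, hn⟩ := exists_nat_ge |(Real.log |x|)|
    exact Set.mem_iUnion.mpr ⟨n, hx, hn⟩
  set A : Set ℝ := {x | x < 0 ∧ |(Real.log |x|)| ≤ a} with hA
  have hAm : MeasurableSet A := measurableSet_Iio.inter
    (measurableSet_le measurable_log_abs.abs measurable_const)
  have hApos : 0 < ν.real A := ENNReal.toReal_pos ha (measure_ne_top _ _)
  have hA1 : ν.real A ≤ 1 := measureReal_le_one
  set q := Real.exp (-(α * (2 * a + T))) * (ε / 2) with hq
  have hqpos : 0 < q := by positivity
  have ha0 : (0 : ℝ) ≤ a := a.cast_nonneg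
  refine ⟨ν.real A * q, by positivity, fun t ht => ?_⟩
  obtain ⟨v, hv, hvε⟩ := hwin (t + a + T) (by positivity)
  have hexp : ∀ w, t - a ≤ w → Real.exp (-(α * (2 * a + T))) ≤ Real.exp (-(α * (v - w))) :=
    fun w hw => Real.exp_le_exp.mpr (neg_le_neg
      (mul_le_mul_of_nonneg_left (by linarith [hv.2]) hα.le))
  rcases le_total (ε / 2) (G (Real.exp v)) with hG | hG
  · have h1 := hreg v t (by linarith [hv.1]) 1
    rw [one_mul, one_mul] at h1
    calc ν.real A * q ≤ q := mul_le_of_le_one_left hqpos.le hA1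
      _ ≤ Real.exp (-(α * (v - t))) * G (Real.exp v) :=
        mul_le_mul (hexp t (by linarith)) hG (by positivity) (Real.exp_pos _).le
      _ ≤ _ := h1
  · have hG' : ε / 2 ≤ G (-Real.exp v) := by
      unfold signSum at hvε
      linarith
    have hintG := integrable_comp_div (ν := ν) h.measurable h.abs_le_one (Real.exp t)
    calc ν.real A * q = ∫ x in A, q ∂ν := by simp
      _ ≤ ∫ x in A, G (Real.exp t / x) ∂ν := by
        refine setIntegral_mono_on (integrable_const _) hintG.integrableOn hAm fun x hx => ?_
        have hx' := abs_le.mp hx.2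
        have h1 := hreg v (t - Real.log |x|) (by linarith [hv.1]) (-1)
        have h2 : -1 * Real.exp (t - Real.log |x|) = Real.exp t / x := by
          rw [Real.exp_sub, Real.exp_log (abs_pos.mpr hx.1.ne), abs_of_neg hx.1, div_neg]
          ring
        rw [h2, neg_one_mul] at h1
        exact (mul_le_mul (hexp _ (by linarith)) hG' (by positivity) (Real.exp_pos _).le).trans h1
      _ ≤ ∫ x, G (Real.exp t / x) ∂ν :=
        setIntegral_le_integral hintG (Eventually.of_forall fun x => h.nonneg _)
      _ ≤ G (Real.exp t) := h.superharmonic _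

end IsRescaledTail

/-! ### Convergence of the rescaled tail -/

/-- The logarithmic moving average of `G` over a window of length `η`. -/
noncomputable def logAverage (G : ℝ → ℝ) (η y : ℝ) : ℝ := ∫ s in (0 : ℝ)..η, G (y * Real.exp (-s))

namespace IsRescaledTail

variable {ν : Measure ℝ} {α : ℝ} {G : ℝ → ℝ}

lemma intervalIntegrable_mul_exp_neg (h : IsRescaledTail ν α G) (y a b : ℝ) :
    IntervalIntegrable (fun s => G (y * Real.exp (-s))) volume a b :=
  intervalIntegrable_of_measurable_of_bounded
    (h.measurable.comp (measurable_const.mul (Real.measurable_exp.comp measurable_neg)))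
    (fun _ => h.abs_le_one _) a b

lemma abs_integral_mul_exp_neg_le (h : IsRescaledTail ν α G) (y a b : ℝ) :
    |∫ s in a..b, G (y * Real.exp (-s))| ≤ |b - a| := by
  have := intervalIntegral.norm_integral_le_of_norm_le_const (a := a) (b := b)
    (f := fun s => G (y * Real.exp (-s))) (C := 1) fun s _ => by
      simpa using h.abs_le_one (y * Real.exp (-s))
  simpa using this

lemma measurable_logAverage (h : IsRescaledTail ν α G) {η : ℝ} (hη : 0 < η) :
    Measurable (logAverage G η) := by
  have hm : Measurable fun p : ℝ × ℝ => G (p.1 * Real.exp (-p.2)) :=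
    h.measurable.comp (measurable_fst.mul (Real.measurable_exp.comp measurable_snd.neg))
  have := (hm.stronglyMeasurable.integral_prod_right'
    (ν := volume.restrict (Set.Ioc 0 η))).measurable
  convert this using 2 with y
  exact intervalIntegral.integral_of_le hη.le

lemma isLogLipschitzHarmonic_logAverage [IsProbabilityMeasure ν] (h : IsRescaledTail ν α G)
    {η : ℝ} (hη : 0 < η) :
    IsLogLipschitzHarmonic ν (logAverage G η) η 2 (Real.exp η) where
  measurable := h.measurable_logAverage hη
  bounded y := by
    simpa [logAverage, abs_of_pos hη] using h.abs_integral_mul_exp_neg_le y 0 η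
  lipschitz y r := by
    have hshift : logAverage G η (y * Real.exp r) =
        ∫ s in (-r)..(η - r), G (y * Real.exp (-s)) := by
      have := intervalIntegral.integral_comp_sub_right (a := 0) (b := η)
        (fun s => G (y * Real.exp (-s))) r
      rw [zero_sub] at this
      rw [← this]
      unfold logAverage
      congr 1 with s
      rw [mul_assoc, ← Real.exp_add]
      ring_nf
    have hint := h.intervalIntegrable_mul_exp_neg y
    have hsplit : logAverage G η (y * Real.exp r) - logAverage G η y =
        (∫ s in (-r)..0, G (y * Real.exp (-s))) + ∫ s in η..(η - r), G (y * Real.exp (-s)) := by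
      rw [hshift, logAverage, ← intervalIntegral.integral_add_adjacent_intervals
        (hint (-r) 0) (hint 0 (η - r)), ← intervalIntegral.integral_add_adjacent_intervals
        (hint 0 η) (hint η (η - r))]
      ring
    rw [hsplit]
    have h1 := h.abs_integral_mul_exp_neg_le y (-r) 0
    have h2 := h.abs_integral_mul_exp_neg_le y η (η - r)
    rw [show (0 : ℝ) - -r = r by ring] at h1
    rw [show η - r - η = -r by ring, abs_neg] at h2
    exact (abs_add_le _ _).trans (by linarith)
  harmonic y hy := by
    have hm : Measurable fun p : ℝ × ℝ => G (y / p.2 * Real.exp (-p.1)) :=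
      h.measurable.comp ((measurable_const.div measurable_snd).mul
        (Real.measurable_exp.comp measurable_fst.neg))
    have : IsFiniteMeasure (volume.restrict (Set.uIoc 0 η)) := ⟨by simp [Set.uIoc]⟩
    have hprod : Integrable (Function.uncurry fun (s : ℝ) (x : ℝ) => G (y / x * Real.exp (-s)))
        ((volume.restrict (Set.uIoc 0 η)).prod ν) := by
      refine (integrable_const 1).mono' hm.aestronglyMeasurable
        (Eventually.of_forall fun p => ?_)
      rw [Real.norm_eq_abs]
      exact h.abs_le_one _
    unfold logAverage
    rw [← intervalIntegral_integral_swap hprod]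
    refine intervalIntegral.integral_congr fun s hs => ?_
    rw [Set.uIcc_of_le hη.le] at hs
    have hge : 1 ≤ |y * Real.exp (-s)| := by
      rw [abs_mul, Real.abs_exp]
      calc 1 = Real.exp s * Real.exp (-s) := by rw [← Real.exp_add]; simp
        _ ≤ |y| * Real.exp (-s) := mul_le_mul_of_nonneg_right
          ((Real.exp_le_exp.mpr hs.2).trans hy) (Real.exp_pos _).le
    have hnot : y * Real.exp (-s) ∉ Set.Ioo (0 : ℝ) 1 := fun hmem => by
      rw [abs_of_pos hmem.1] at hge
      linarith [hmem.2]
    change G (y * Real.exp (-s)) = _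
    rw [h.harmonic _ hnot]
    congr 1 with x
    rw [div_mul_eq_mul_div]

lemma le_logAverage (h : IsRescaledTail ν α G) (hα : 0 < α) {η : ℝ} (hη : 0 < η) (y : ℝ) :
    η * (Real.exp (-(α * η)) * G y) ≤ logAverage G η y := by
  have h1 : ∫ _ in (0 : ℝ)..η, Real.exp (-(α * η)) * G y ≤ logAverage G η y := by
    refine intervalIntegral.integral_mono_on hη.le intervalIntegrable_const
      (h.intervalIntegrable_mul_exp_neg y 0 η) fun s hs => le_trans ?_ (h.regular y s hs.1)
    exact mul_le_mul_of_nonneg_right (Real.exp_le_exp.mpr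
      (neg_le_neg (mul_le_mul_of_nonneg_left hs.2 hα.le))) (h.nonneg y)
  rwa [intervalIntegral.integral_const, sub_zero, smul_eq_mul] at h1

lemma logAverage_le (h : IsRescaledTail ν α G) (hα : 0 < α) {η : ℝ} (hη : 0 < η) (y : ℝ) :
    logAverage G η (y * Real.exp η) ≤ η * (Real.exp (α * η) * G y) := by
  have h1 : logAverage G η (y * Real.exp η) ≤ ∫ _ in (0 : ℝ)..η, Real.exp (α * η) * G y := by
    refine intervalIntegral.integral_mono_on hη.le (h.intervalIntegrable_mul_exp_neg _ 0 η)
      intervalIntegrable_const fun s hs => ?_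
    have h2 := h.regular (y * Real.exp η * Real.exp (-s)) (η - s) (by linarith [hs.2])
    have hy : y * Real.exp η * Real.exp (-s) * Real.exp (-(η - s)) = y := by
      rw [mul_assoc, mul_assoc, ← Real.exp_add, ← Real.exp_add,
        show η + (-s + -(η - s)) = 0 by ring, Real.exp_zero, mul_one]
    rw [hy, Real.exp_neg (α * (η - s)), inv_mul_le_iff₀ (Real.exp_pos _)] at h2
    exact h2.trans (mul_le_mul_of_nonneg_right (Real.exp_le_exp.mpr
      (mul_le_mul_of_nonneg_left (by linarith [hs.1]) hα.le)) (h.nonneg y))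
  rwa [intervalIntegral.integral_const, sub_zero, smul_eq_mul] at h1

/-- In the non-arithmetic case the rescaled tail converges: its moving averages do, and `G`
oscillates by a factor of at most `e ^ (2 α η)` about the averages over windows of length `η`. -/
theorem exists_tendsto_atTop [IsProbabilityMeasure ν] (h : IsRescaledTail ν α G) (hα : 0 < α)
    (h0 : ν {0} = 0) (hi : Integrable (fun x => Real.log |x|) ν)
    (hm : 0 < ∫ x, Real.log |x| ∂ν) (hneg : ν (Set.Iio 0) ≠ 0)
    (hna : ¬∃ a : ℝ, a ≠ 0 ∧ logSupport ν ⊆ (AddSubgroup.zmultiples a : Set ℝ)) :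
    ∃ ℓ, Tendsto G atTop (𝓝 ℓ) := by
  have hbu : IsBoundedUnder (· ≤ ·) atTop G := isBoundedUnder_of ⟨1, h.le_one⟩
  have hbl : IsBoundedUnder (· ≥ ·) atTop G := isBoundedUnder_of ⟨0, h.nonneg⟩
  have hosc : ∀ η > 0, limsup G atTop ≤ Real.exp (2 * α * η) * liminf G atTop := by
    intro η hη
    obtain ⟨ℓ, hℓ⟩ := (h.isLogLipschitzHarmonic_logAverage hη).exists_tendsto_cobounded
      h0 hi hm hneg hna
    have hℓtop : Tendsto (logAverage G η) atTop (𝓝 ℓ) :=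
      hℓ.mono_left (by rw [IsOrderBornology.cobounded_eq]; exact le_sup_right)
    have hup : limsup G atTop ≤ Real.exp (α * η) / η * ℓ := by
      have ht : Tendsto (fun y => Real.exp (α * η) / η * logAverage G η y) atTop
          (𝓝 (Real.exp (α * η) / η * ℓ)) := hℓtop.const_mul _
      rw [← ht.limsup_eq]
      refine limsup_le_limsup (Eventually.of_forall fun y => ?_) hbl.isCoboundedUnder_le
        ht.isBoundedUnder_le
      have h1 := h.le_logAverage hα hη y
      rw [Real.exp_neg, mul_left_comm, inv_mul_le_iff₀ (Real.exp_pos _)] at h1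
      change G y ≤ Real.exp (α * η) / η * logAverage G η y
      rw [div_mul_eq_mul_div, le_div_iff₀ hη]
      linarith
    have hlow : Real.exp (-(α * η)) / η * ℓ ≤ liminf G atTop := by
      have ht : Tendsto (fun y => Real.exp (-(α * η)) / η * logAverage G η (y * Real.exp η)) atTop
          (𝓝 (Real.exp (-(α * η)) / η * ℓ)) :=
        (hℓtop.comp (tendsto_id.atTop_mul_const (Real.exp_pos η))).const_mul _
      rw [← ht.liminf_eq]
      refine liminf_le_liminf (Eventually.of_forall fun y => ?_) ht.isBoundedUnder_ge
        hbu.isCoboundedUnder_ge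
      have h1 := h.logAverage_le hα hη y
      change Real.exp (-(α * η)) / η * logAverage G η (y * Real.exp η) ≤ G y
      rw [Real.exp_neg, div_mul_eq_mul_div, div_le_iff₀ hη, inv_mul_le_iff₀ (Real.exp_pos _)]
      linarith
    calc limsup G atTop ≤ Real.exp (α * η) / η * ℓ := hup
      _ = Real.exp (2 * α * η) * (Real.exp (-(α * η)) / η * ℓ) := by
        rw [show 2 * α * η = α * η + α * η by ring, Real.exp_add, Real.exp_neg]
        field_simp
      _ ≤ _ := mul_le_mul_of_nonneg_left hlow (Real.exp_pos _).le
  have hlim : Tendsto (fun η => Real.exp (2 * α * η) * liminf G atTop) (𝓝[>] 0)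
      (𝓝 (liminf G atTop)) := by
    have hc : Continuous fun η => Real.exp (2 * α * η) * liminf G atTop := by fun_prop
    have := hc.tendsto 0
    simp only [mul_zero, Real.exp_zero, one_mul] at this
    exact this.mono_left nhdsWithin_le_nhds
  have hle : limsup G atTop ≤ liminf G atTop :=
    ge_of_tendsto hlim (eventually_mem_nhdsWithin.mono hosc)
  exact ⟨_, tendsto_of_liminf_eq_limsup (le_antisymm (liminf_le_limsup hbu hbl) hle) rfl hbu hbl⟩

end IsRescaledTail

/-! ### The rescaled tail of the multiplicative random walk -/

/-- Prepending a first factor to a sequence of factors. -/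
def seqCons (x : ℝ) (w : ℕ → ℝ) : ℕ → ℝ
  | 0 => x
  | n + 1 => w n

lemma measurable_seqCons : Measurable fun p : ℝ × (ℕ → ℝ) => seqCons p.1 p.2 := by
  refine measurable_pi_lambda _ fun n => ?_
  cases n with
  | zero => exact measurable_fst
  | succ n => exact (measurable_pi_apply n).comp measurable_snd

section InfiniteProduct

variable {μ : Measure ℝ} [IsProbabilityMeasure μ]

lemma map_seqCons_prod_infinitePi :
    (μ.prod (Measure.infinitePi fun _ : ℕ => μ)).map (fun p => seqCons p.1 p.2) =
      Measure.infinitePi fun _ : ℕ => μ := by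
  classical
  refine Measure.eq_infinitePi _ fun s t ht => ?_
  obtain ⟨N, hN⟩ : ∃ N, s ⊆ Finset.range (N + 1) :=
    ⟨s.sup id, fun i hi => Finset.mem_range.mpr (Nat.lt_succ_of_le (Finset.le_sup (f := id) hi))⟩
  set t' : ℕ → Set ℝ := fun i => if i ∈ s then t i else Set.univ with ht'
  have ht'm : ∀ i, MeasurableSet (t' i) := fun i => by
    simp only [ht']
    split_ifs
    exacts [ht i, MeasurableSet.univ]
  have hpi : Set.pi (s : Set ℕ) t = Set.pi (Finset.range (N + 1) : Set ℕ) t' := by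
    ext w
    simp only [Set.mem_pi, Finset.mem_coe, ht']
    refine ⟨fun h i _ => ?_, fun h i hi => by simpa [hi] using h i (hN hi)⟩
    split_ifs with hi
    exacts [h i hi, Set.mem_univ _]
  have hprod : ∏ i ∈ s, μ (t i) = ∏ i ∈ Finset.range (N + 1), μ (t' i) := by
    rw [← Finset.prod_subset hN fun i _ hi => by simp [ht', hi]]
    exact Finset.prod_congr rfl fun i hi => by simp [ht', hi]
  have hpre : (fun p : ℝ × (ℕ → ℝ) => seqCons p.1 p.2) ⁻¹'
      Set.pi (Finset.range (N + 1) : Set ℕ) t' =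
      t' 0 ×ˢ Set.pi (Finset.range N : Set ℕ) (fun i => t' (i + 1)) := by
    ext ⟨x, w⟩
    simp only [Set.mem_preimage, Set.mem_pi, Finset.mem_coe, Finset.mem_range, Set.mem_prod]
    refine ⟨fun h => ⟨h 0 (by omega), fun i hi => h (i + 1) (by omega)⟩, fun h i hi => ?_⟩
    cases i with
    | zero => exact h.1
    | succ i => exact h.2 i (by omega)
  rw [hpi, hprod, Measure.map_apply measurable_seqCons
    (MeasurableSet.pi (Finset.range (N + 1)).countable_toSet fun i _ => ht'm i), hpre,
    Measure.prod_prod, Measure.infinitePi_pi _ fun i _ => ht'm _, Finset.prod_range_succ', mul_comm]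

/-- Conditioning on the first coordinate of a sequence of independent variables. -/
lemma infinitePi_real_eq_integral {S : Set (ℕ → ℝ)} (hS : MeasurableSet S) :
    (Measure.infinitePi fun _ : ℕ => μ).real S =
      ∫ x, (Measure.infinitePi fun _ : ℕ => μ).real {w | seqCons x w ∈ S} ∂μ := by
  have hpre : MeasurableSet ((fun p : ℝ × (ℕ → ℝ) => seqCons p.1 p.2) ⁻¹' S) :=
    measurable_seqCons hS
  have hmeas : Measurable fun x => (Measure.infinitePi fun _ : ℕ => μ) {w | seqCons x w ∈ S} :=
    measurable_measure_prodMk_left hpre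
  unfold Measure.real
  rw [integral_toReal hmeas.aemeasurable (Eventually.of_forall fun x => measure_lt_top _ _)]
  congr 1
  conv_lhs => rw [← map_seqCons_prod_infinitePi (μ := μ)]
  rw [Measure.map_apply measurable_seqCons hS, Measure.prod_apply hpre]
  rfl

end InfiniteProduct

/-- The event that one of the partial products of length at most `N` (the empty one included) lies
beyond `y`, that is, on the same side of the origin as `y` and farther away from it. -/
def beyondUpTo (N : ℕ) (y : ℝ) : Set (ℕ → ℝ) :=
  {w | ∃ n ≤ N, 1 < (∏ i ∈ Finset.range n, w i) / y}

/-- The event that some partial product (the empty one included) lies beyond `y`. -/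
def beyond (y : ℝ) : Set (ℕ → ℝ) := {w | ∃ n, 1 < (∏ i ∈ Finset.range n, w i) / y}

lemma one_lt_one_div_iff_mem_Ioo {y : ℝ} : 1 < 1 / y ↔ y ∈ Set.Ioo 0 1 := by
  constructor
  · intro h
    have hy : 0 < y := one_div_pos.mp (one_pos.trans h)
    exact ⟨hy, by rwa [lt_div_iff₀ hy, one_mul] at h⟩
  · rintro ⟨h0, h1⟩
    rwa [lt_div_iff₀ h0, one_mul]

lemma prod_range_succ_seqCons_div (x : ℝ) (w : ℕ → ℝ) (n : ℕ) (y : ℝ) :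
    (∏ i ∈ Finset.range (n + 1), seqCons x w i) / y =
      (∏ i ∈ Finset.range n, w i) / (y / x) := by
  rw [Finset.prod_range_succ', div_div_eq_mul_div]
  rfl

lemma seqCons_mem_beyondUpTo_succ {N : ℕ} {y : ℝ} (hy : y ∉ Set.Ioo 0 1) (x : ℝ) (w : ℕ → ℝ) :
    seqCons x w ∈ beyondUpTo (N + 1) y ↔ w ∈ beyondUpTo N (y / x) := by
  constructor
  · rintro ⟨n, hn, h⟩
    cases n with
    | zero => exact absurd (one_lt_one_div_iff_mem_Ioo.mp (by simpa using h)) hy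
    | succ n => exact ⟨n, by omega, by rwa [← prod_range_succ_seqCons_div]⟩
  · rintro ⟨n, hn, h⟩
    exact ⟨n + 1, by omega, by rwa [prod_range_succ_seqCons_div]⟩

lemma seqCons_mem_beyond {y : ℝ} (hy : y ∉ Set.Ioo 0 1) (x : ℝ) (w : ℕ → ℝ) :
    seqCons x w ∈ beyond y ↔ w ∈ beyond (y / x) := by
  constructor
  · rintro ⟨n, h⟩
    cases n with
    | zero => exact absurd (one_lt_one_div_iff_mem_Ioo.mp (by simpa using h)) hy
    | succ n => exact ⟨n, by rwa [← prod_range_succ_seqCons_div]⟩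
  · rintro ⟨n, h⟩
    exact ⟨n + 1, by rwa [prod_range_succ_seqCons_div]⟩

lemma beyond_eq_univ {y : ℝ} (hy : y ∈ Set.Ioo 0 1) : beyond y = Set.univ :=
  Set.eq_univ_of_forall fun w => ⟨0, by simpa using one_lt_one_div_iff_mem_Ioo.mpr hy⟩

lemma beyond_eq_iUnion (y : ℝ) : beyond y = ⋃ N, beyondUpTo N y := by
  ext w
  simp only [beyond, beyondUpTo, Set.mem_ofPred_eq, Set.mem_iUnion]
  exact ⟨fun ⟨n, h⟩ => ⟨n, n, le_rfl, h⟩, fun ⟨_, n, _, h⟩ => ⟨n, h⟩⟩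

lemma monotone_beyondUpTo (y : ℝ) : Monotone fun N => beyondUpTo N y :=
  fun _ _ hNM _ ⟨n, hn, h⟩ => ⟨n, hn.trans hNM, h⟩

lemma measurable_prod_range (n : ℕ) : Measurable fun w : ℕ → ℝ => ∏ i ∈ Finset.range n, w i :=
  Finset.measurable_prod _ fun i _ => measurable_pi_apply i

lemma measurableSet_beyond_prod : MeasurableSet {p : ℝ × (ℕ → ℝ) | p.2 ∈ beyond p.1} := by
  have heq : {p : ℝ × (ℕ → ℝ) | p.2 ∈ beyond p.1} =
      ⋃ n, {p : ℝ × (ℕ → ℝ) | 1 < (∏ i ∈ Finset.range n, p.2 i) / p.1} := by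
    ext p
    simp [beyond]
  rw [heq]
  exact MeasurableSet.iUnion fun n => measurableSet_lt measurable_const
    (((measurable_prod_range n).comp measurable_snd).div measurable_fst)

lemma measurableSet_beyond (y : ℝ) : MeasurableSet (beyond y) :=
  measurableSet_beyond_prod.preimage (measurable_const.prodMk measurable_id)

lemma measurableSet_beyondUpTo (N : ℕ) (y : ℝ) : MeasurableSet (beyondUpTo N y) := by
  simp only [beyondUpTo, ← exists_prop, Set.ofPred_exists]
  exact MeasurableSet.iUnion fun n => MeasurableSet.iUnion fun _ =>
    measurableSet_lt measurable_const ((measurable_prod_range n).div_const y)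

/-- The probability that the multiplicative random walk with factors of law `μ` ever lies beyond
`y`. -/
noncomputable def beyondProb (μ : Measure ℝ) [IsProbabilityMeasure μ] (y : ℝ) : ℝ :=
  (Measure.infinitePi fun _ : ℕ => μ).real (beyond y)

/-- The law `μ` tilted by the density `|x| ^ α`. -/
noncomputable def tiltedLaw (μ : Measure ℝ) (α : ℝ) : Measure ℝ :=
  μ.withDensity fun x => ENNReal.ofReal (|x| ^ α)

section TiltedLaw

variable {μ : Measure ℝ} {α : ℝ}

lemma measurable_abs_rpow : Measurable fun x : ℝ => |x| ^ α := measurable_id.abs.pow_const α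

lemma integral_tiltedLaw (f : ℝ → ℝ) :
    ∫ x, f x ∂(tiltedLaw μ α) = ∫ x, |x| ^ α * f x ∂μ := by
  unfold tiltedLaw
  rw [integral_withDensity_eq_integral_toReal_smul measurable_abs_rpow.ennreal_ofReal
    (Eventually.of_forall fun x => ENNReal.ofReal_lt_top)]
  congr 1 with x
  rw [ENNReal.toReal_ofReal (by positivity), smul_eq_mul]

lemma isProbabilityMeasure_tiltedLaw (hmom : ∫ x, |x| ^ α ∂μ = 1) :
    IsProbabilityMeasure (tiltedLaw μ α) := by
  have hmomi : Integrable (fun x => |x| ^ α) μ := integrable_of_integral_eq_one hmom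
  constructor
  rw [tiltedLaw, withDensity_apply _ MeasurableSet.univ, Measure.restrict_univ,
    ← ofReal_integral_eq_lintegral_ofReal hmomi (Eventually.of_forall fun x => by positivity),
    hmom, ENNReal.ofReal_one]

lemma integrable_log_tiltedLaw (hlog : Integrable (fun x => |x| ^ α * Real.log |x|) μ) :
    Integrable (fun x => Real.log |x|) (tiltedLaw μ α) := by
  rw [tiltedLaw, integrable_withDensity_iff_integrable_smul'
    measurable_abs_rpow.ennreal_ofReal (Eventually.of_forall fun x => ENNReal.ofReal_lt_top)]
  refine hlog.congr (Eventually.of_forall fun x => ?_)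
  simp only [smul_eq_mul]
  rw [ENNReal.toReal_ofReal (by positivity)]

/-- A set of nonzero points is null for the tilted law only if it is null for the law itself. -/
lemma measure_eq_zero_of_tiltedLaw_eq_zero {s : Set ℝ} (hs : ∀ x ∈ s, x ≠ 0)
    (h : tiltedLaw μ α s = 0) : μ s = 0 := by
  rw [tiltedLaw, withDensity_apply_eq_zero measurable_abs_rpow.ennreal_ofReal] at h
  refine measure_mono_null (fun x hx => Set.mem_inter ?_ hx) h
  have := abs_pos.mpr (hs x hx)
  exact (ENNReal.ofReal_pos.mpr (by positivity)).ne'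

lemma tiltedLaw_singleton_zero (hα : 0 < α) : tiltedLaw μ α {0} = 0 := by
  rw [tiltedLaw, withDensity_apply_eq_zero measurable_abs_rpow.ennreal_ofReal]
  convert measure_empty (μ := μ)
  ext x
  simp only [Set.mem_inter_iff, Set.mem_ofPred_eq, Set.mem_singleton_iff, Set.mem_empty_iff_false,
    iff_false, not_and]
  rintro hx rfl
  simp [Real.zero_rpow hα.ne'] at hx

end TiltedLaw

section Tail

variable {μ : Measure ℝ} [IsProbabilityMeasure μ] {α : ℝ}

lemma beyondProb_nonneg (y : ℝ) : 0 ≤ beyondProb μ y := measureReal_nonneg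

lemma beyondProb_le_one (y : ℝ) : beyondProb μ y ≤ 1 := measureReal_le_one

lemma beyondProb_zero : beyondProb μ 0 = 0 := by
  simp [beyondProb, beyond, not_lt.mpr zero_le_one]

lemma beyondProb_of_mem_Ioo {y : ℝ} (hy : y ∈ Set.Ioo 0 1) : beyondProb μ y = 1 := by
  simp [beyondProb, beyond_eq_univ hy]

lemma measurable_beyondProb : Measurable (beyondProb μ) :=
  (measurable_measure_prodMk_left measurableSet_beyond_prod).ennreal_toReal

lemma beyondProb_eq_integral {y : ℝ} (hy : y ∉ Set.Ioo 0 1) :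
    beyondProb μ y = ∫ x, beyondProb μ (y / x) ∂μ := by
  unfold beyondProb
  rw [infinitePi_real_eq_integral (measurableSet_beyond y)]
  simp only [seqCons_mem_beyond hy, Set.ofPred_mem_eq]

lemma beyondProb_le_mul_exp_neg (y : ℝ) {s : ℝ} (hs : 0 ≤ s) :
    beyondProb μ y ≤ beyondProb μ (y * Real.exp (-s)) := by
  refine measureReal_mono fun w ⟨n, hn⟩ => ⟨n, hn.trans_le ?_⟩
  rw [Real.exp_neg, ← div_eq_mul_inv, div_div_eq_mul_div, mul_div_right_comm]
  exact le_mul_of_one_le_right (one_pos.trans hn).le (Real.one_le_exp hs)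

/-- A Markov-type bound: the process `|Π n| ^ α` has constant expectation. The proof is by induction
on the length of the products, conditioning on the first factor. -/
lemma infinitePi_beyondUpTo_le (hα : 0 < α) (hmom : ∫ x, |x| ^ α ∂μ = 1) (N : ℕ) (y : ℝ) :
    (Measure.infinitePi fun _ : ℕ => μ).real (beyondUpTo N y) ≤ |y⁻¹| ^ α := by
  have hmomi : Integrable (fun x => |x| ^ α) μ := integrable_of_integral_eq_one hmom
  induction N generalizing y with
  | zero =>
    by_cases hy : y ∈ Set.Ioo 0 1
    · refine measureReal_le_one.trans (Real.one_le_rpow ?_ hα.le)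
      rw [abs_of_pos (inv_pos.mpr hy.1)]
      exact (one_le_inv₀ hy.1).mpr hy.2.le
    · have : beyondUpTo 0 y = ∅ := by
        refine Set.eq_empty_of_forall_notMem fun w ⟨n, hn, h⟩ => hy ?_
        obtain rfl : n = 0 := by omega
        exact one_lt_one_div_iff_mem_Ioo.mp (by simpa using h)
      rw [this, measureReal_empty]
      positivity
  | succ N ih =>
    by_cases hy : y ∈ Set.Ioo 0 1
    · refine measureReal_le_one.trans (Real.one_le_rpow ?_ hα.le)
      rw [abs_of_pos (inv_pos.mpr hy.1)]
      exact (one_le_inv₀ hy.1).mpr hy.2.le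
    · rw [infinitePi_real_eq_integral (measurableSet_beyondUpTo _ y)]
      simp only [seqCons_mem_beyondUpTo_succ hy, Set.ofPred_mem_eq]
      calc _ ≤ ∫ x, |y⁻¹| ^ α * |x| ^ α ∂μ := by
            refine integral_mono_of_nonneg (Eventually.of_forall fun x => measureReal_nonneg)
              (hmomi.const_mul _) (Eventually.of_forall fun x => (ih (y / x)).trans_eq ?_)
            rw [inv_div, div_eq_mul_inv, mul_comm x, abs_mul,
              Real.mul_rpow (abs_nonneg _) (abs_nonneg _)]
        _ = |y⁻¹| ^ α := by rw [integral_const_mul, hmom, mul_one]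

lemma beyondProb_le (hα : 0 < α) (hmom : ∫ x, |x| ^ α ∂μ = 1) (y : ℝ) :
    beyondProb μ y ≤ |y⁻¹| ^ α := by
  have hlim := tendsto_measure_iUnion_atTop (μ := Measure.infinitePi fun _ : ℕ => μ)
    (monotone_beyondUpTo y)
  rw [← beyond_eq_iUnion] at hlim
  exact le_of_tendsto ((ENNReal.tendsto_toReal (measure_ne_top _ _)).comp hlim)
    (Eventually.of_forall fun N => infinitePi_beyondUpTo_le hα hmom N y)

/-- The drift under the tilted law is the relative entropy of the tilted law, up to the factor
`α`, and therefore positive. -/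
lemma integral_log_tiltedLaw_pos (hα : 0 < α) (hmom : ∫ x, |x| ^ α ∂μ = 1)
    (hlog : Integrable (fun x => |x| ^ α * Real.log |x|) μ) (h1 : ¬∀ᵐ x ∂μ, |x| = 1) :
    0 < ∫ x, Real.log |x| ∂(tiltedLaw μ α) := by
  have hmomi : Integrable (fun x => |x| ^ α) μ := integrable_of_integral_eq_one hmom
  have hkl : ∀ x : ℝ, InformationTheory.klFun (|x| ^ α) =
      α * (|x| ^ α * Real.log |x|) + (1 - |x| ^ α) := by
    intro x
    rw [InformationTheory.klFun_apply]
    by_cases hx : x = 0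
    · simp [hx, Real.zero_rpow hα.ne']
    · rw [Real.log_rpow (abs_pos.mpr hx)]
      ring
  have hint1 : Integrable (fun x => α * (|x| ^ α * Real.log |x|)) μ := hlog.const_mul α
  have hint2 : Integrable (fun x => 1 - |x| ^ α) μ := (integrable_const 1).sub hmomi
  have hnn : ∀ x : ℝ, 0 ≤ InformationTheory.klFun (|x| ^ α) := fun x =>
    InformationTheory.klFun_nonneg (by positivity)
  have hI : ∫ x, InformationTheory.klFun (|x| ^ α) ∂μ =
      α * ∫ x, Real.log |x| ∂(tiltedLaw μ α) := by
    rw [integral_tiltedLaw]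
    simp_rw [hkl]
    rw [integral_add hint1 hint2, integral_const_mul, integral_sub (integrable_const 1) hmomi,
      hmom]
    simp
  have hint : Integrable (fun x : ℝ => InformationTheory.klFun (|x| ^ α)) μ := by
    simp_rw [hkl]
    exact hint1.add hint2
  refine pos_of_mul_pos_right (hI ▸ lt_of_le_of_ne (integral_nonneg hnn) fun hzero => h1 ?_) hα.le
  filter_upwards [(integral_eq_zero_iff_of_nonneg hnn hint).mp hzero.symm] with x hx
  have hx1 := (InformationTheory.klFun_eq_zero_iff (by positivity)).mp hx
  exact (Real.rpow_left_inj (abs_nonneg x) zero_le_one hα.ne').mp (by rw [hx1, Real.one_rpow])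

lemma exists_measure_abs_le_exp_ne_zero (hα : 0 < α) (hmom : ∫ x, |x| ^ α ∂μ = 1)
    (h1 : ¬∀ᵐ x ∂μ, |x| = 1) :
    ∃ δ > 0, μ {x | |x| ≤ Real.exp (-(2 * δ))} ≠ 0 := by
  have hmomi : Integrable (fun x => |x| ^ α) μ := integrable_of_integral_eq_one hmom
  by_contra! hcon
  have hge : ∀ᵐ x ∂μ, 1 ≤ |x| := by
    rw [ae_iff]
    refine measure_mono_null (fun x hx => ?_) (measure_iUnion_null fun n : ℕ =>
      hcon (1 / ((n : ℝ) + 1)) (by positivity))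
    have hx1 : |x| < 1 := not_le.mp hx
    rw [Set.mem_iUnion]
    have hlim : Tendsto (fun n : ℕ => Real.exp (-(2 * (1 / ((n : ℝ) + 1))))) atTop (𝓝 1) := by
      have := (tendsto_one_div_add_atTop_nhds_zero_nat (𝕜 := ℝ)).const_mul 2
      simpa [Function.comp_def] using (Real.continuous_exp.tendsto _).comp this.neg
    obtain ⟨n, hn⟩ := (hlim.eventually (lt_mem_nhds hx1)).exists
    exact ⟨n, hn.le⟩
  have hnn : 0 ≤ᵐ[μ] fun x => |x| ^ α - 1 := by
    filter_upwards [hge] with x hx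
    exact sub_nonneg.mpr (Real.one_le_rpow hx hα.le)
  have hzero : ∫ x, (|x| ^ α - 1) ∂μ = 0 := by
    rw [integral_sub hmomi (integrable_const 1), hmom]
    simp
  refine h1 ?_
  filter_upwards [(integral_eq_zero_iff_of_nonneg_ae hnn
    (hmomi.sub (integrable_const 1))).mp hzero] with x hx
  have hx1 : |x| ^ α = 1 := by simpa [sub_eq_zero] using hx
  exact (Real.rpow_left_inj (abs_nonneg x) zero_le_one hα.ne').mp (by rw [hx1, Real.one_rpow])

lemma integral_rescaled_tiltedLaw (y : ℝ) :
    ∫ x, |y / x| ^ α * beyondProb μ (y / x) ∂(tiltedLaw μ α) =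
      |y| ^ α * ∫ x, beyondProb μ (y / x) ∂μ := by
  rw [integral_tiltedLaw, ← integral_const_mul]
  congr 1 with x
  by_cases hx : x = 0
  · simp [hx, beyondProb_zero]
  · rw [abs_div, Real.div_rpow (abs_nonneg _) (abs_nonneg _)]
    have : |x| ^ α ≠ 0 := (Real.rpow_pos_of_pos (abs_pos.mpr hx) α).ne'
    field_simp

theorem isRescaledTail_beyondProb (hα : 0 < α) (hmom : ∫ x, |x| ^ α ∂μ = 1)
    (h1 : ¬∀ᵐ x ∂μ, |x| = 1) :
    IsRescaledTail (tiltedLaw μ α) α fun y => |y| ^ α * beyondProb μ y where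
  measurable := measurable_abs_rpow.mul measurable_beyondProb
  nonneg y := mul_nonneg (by positivity) (beyondProb_nonneg y)
  le_one y := by
    by_cases hy : y = 0
    · simp [hy, beyondProb_zero]
    · calc |y| ^ α * beyondProb μ y ≤ |y| ^ α * |y⁻¹| ^ α :=
          mul_le_mul_of_nonneg_left (beyondProb_le hα hmom y) (by positivity)
        _ = 1 := by
          rw [← Real.mul_rpow (abs_nonneg _) (abs_nonneg _), ← abs_mul, mul_inv_cancel₀ hy,
            abs_one, Real.one_rpow]
  le_rpow y := mul_le_of_le_one_right (by positivity) (beyondProb_le_one y)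
  regular y s hs := by
    rw [abs_mul, Real.abs_exp, Real.mul_rpow (abs_nonneg _) (Real.exp_pos _).le, ← Real.exp_mul,
      show -s * α = -(α * s) by ring, mul_comm (|y| ^ α) (Real.exp _), mul_assoc]
    exact mul_le_mul_of_nonneg_left (mul_le_mul_of_nonneg_left
      (beyondProb_le_mul_exp_neg y hs) (by positivity)) (Real.exp_pos _).le
  harmonic y hy := by
    rw [integral_rescaled_tiltedLaw, ← beyondProb_eq_integral hy]
  superharmonic y := by
    rw [integral_rescaled_tiltedLaw]
    by_cases hy : y ∈ Set.Ioo 0 1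
    · rw [beyondProb_of_mem_Ioo hy]
      refine mul_le_mul_of_nonneg_left ?_ (by positivity)
      calc ∫ x, beyondProb μ (y / x) ∂μ ≤ ∫ _, (1 : ℝ) ∂μ :=
            integral_mono_of_nonneg (Eventually.of_forall fun x => beyondProb_nonneg _)
              (integrable_const 1) (Eventually.of_forall fun x => beyondProb_le_one _)
        _ = 1 := by simp
    · rw [← beyondProb_eq_integral hy]
  gap := by
    obtain ⟨δ, hδ, hA⟩ := exists_measure_abs_le_exp_ne_zero hα hmom h1
    set A : Set ℝ := {x | |x| ≤ Real.exp (-(2 * δ))} with hAdef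
    have hAm : MeasurableSet A := measurableSet_le measurable_id.abs measurable_const
    have hApos : 0 < μ.real A := ENNReal.toReal_pos hA (measure_ne_top _ _)
    have hexp1 : Real.exp (-(α * δ)) < 1 := Real.exp_lt_one_iff.mpr (by simpa using by positivity)
    refine ⟨δ, hδ, Real.exp (-(α * δ)) * (μ.real A * (1 - Real.exp (-(α * δ)))),
      mul_pos (Real.exp_pos _) (mul_pos hApos (by linarith)), fun t ht => ?_⟩
    rw [integral_rescaled_tiltedLaw, beyondProb_of_mem_Ioo
      ⟨Real.exp_pos t, Real.exp_lt_one_iff.mpr ht.2⟩, ← mul_sub, Real.abs_exp, ← Real.exp_mul]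
    have hint : Integrable (fun x => 1 - beyondProb μ (Real.exp t / x)) μ :=
      (integrable_const 1).sub (integrable_comp_div measurable_beyondProb (B := 1) (fun y =>
        abs_le.mpr ⟨by linarith [beyondProb_nonneg (μ := μ) y], beyondProb_le_one y⟩) _)
    -- A first factor in `A` sends the walk back by `2 δ` on the logarithmic scale.
    have hlow : μ.real A * (1 - Real.exp (-(α * δ))) ≤
        1 - ∫ x, beyondProb μ (Real.exp t / x) ∂μ := by
      calc μ.real A * (1 - Real.exp (-(α * δ))) = ∫ x in A, (1 - Real.exp (-(α * δ))) ∂μ := by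
            simp
        _ ≤ ∫ x in A, (1 - beyondProb μ (Real.exp t / x)) ∂μ := by
            refine setIntegral_mono_on (integrable_const _) hint.integrableOn hAm fun x hx => ?_
            have hle : |(Real.exp t / x)⁻¹| ≤ Real.exp (-δ) := by
              rw [inv_div, abs_div, Real.abs_exp, div_le_iff₀ (Real.exp_pos _), ← Real.exp_add]
              exact (show |x| ≤ _ from hx).trans (Real.exp_le_exp.mpr (by linarith [ht.1]))
            have h2 := (beyondProb_le hα hmom (Real.exp t / x)).trans
              (Real.rpow_le_rpow (abs_nonneg _) hle hα.le)
            rw [← Real.exp_mul, show -δ * α = -(α * δ) by ring] at h2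
            linarith
        _ ≤ ∫ x, (1 - beyondProb μ (Real.exp t / x)) ∂μ :=
            setIntegral_le_integral hint
              (Eventually.of_forall fun x => sub_nonneg.mpr (beyondProb_le_one _))
        _ = 1 - ∫ x, beyondProb μ (Real.exp t / x) ∂μ := by
            rw [integral_sub (integrable_const 1) (integrable_comp_div measurable_beyondProb
              (B := 1) (fun y => abs_le.mpr ⟨by linarith [beyondProb_nonneg (μ := μ) y],
                beyondProb_le_one y⟩) _)]
            simp
    refine mul_le_mul (Real.exp_le_exp.mpr ?_) hlow
      (mul_nonneg hApos.le (by linarith)) (Real.exp_pos _).le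
    nlinarith [ht.1]

end Tail

/-! ### The maximum of the partial products -/

section Main

variable {Ω : Type*} [MeasurableSpace Ω] {P : Measure Ω}

/-- Above level `1` the empty product does not matter, and the tail of the maximum is the
probability that the walk ever lies beyond the level. -/
lemma measureReal_lt_maxProd_eq_beyondProb {X : Ω → ℝ} {Xs : ℕ → Ω → ℝ} {μ : Measure ℝ}
    [IsProbabilityMeasure μ] (hμ : μ = P.map X) (hXs : ∀ i, Measurable (Xs i))
    (hident : ∀ i, IdentDistrib (Xs i) X P P) (hindep : iIndepFun Xs P) {x : ℝ} (hx : 1 ≤ x) :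
    P.real {ω | (x : EReal) < maxProd Xs ω} = beyondProb μ x := by
  have hlaw : P.map (fun ω i => Xs i ω) = Measure.infinitePi fun _ : ℕ => μ := by
    rw [hindep.map_fun_eq_infinitePi_map hXs]
    congr 1 with i : 1
    rw [hμ, (hident i).map_eq]
  have hpre : {ω | (x : EReal) < maxProd Xs ω} = (fun ω i => Xs i ω) ⁻¹' beyond x := by
    ext ω
    simp only [maxProd, partialProd, beyond, Set.mem_ofPred_eq, Set.mem_preimage, lt_iSup_iff,
      EReal.coe_lt_coe_iff, exists_prop, one_lt_div (one_pos.trans_le hx)]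
    refine ⟨fun ⟨n, _, h⟩ => ⟨n, h⟩, fun ⟨n, h⟩ => ⟨n, ?_, h⟩⟩
    rw [Nat.one_le_iff_ne_zero]
    rintro rfl
    simp only [Finset.range_zero, Finset.prod_empty] at h
    exact h.not_ge hx
  rw [beyondProb, ← hlaw, hpre, map_measureReal_apply (measurable_pi_lambda _ hXs)
    (measurableSet_beyond x)]

lemma support_condLogLaw_subset_logSupport {X : Ω → ℝ} (hX : Measurable X) (α : ℝ) :
    (condLogLaw P X).support ⊆ logSupport (tiltedLaw (P.map X) α) := by
  intro t ht
  by_contra hcon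
  have hexp : ∀ x : ℝ, |x| = Real.exp t → ∃ U ∈ 𝓝 x, tiltedLaw (P.map X) α U = 0 := by
    intro x hx
    rw [← Measure.notMem_support_iff_exists]
    intro hmem
    refine hcon ⟨x, hmem, ?_, by rw [hx, Real.log_exp]⟩
    rintro rfl
    simp [(Real.exp_pos t).ne] at hx
  obtain ⟨U, hU, hU0⟩ := hexp (Real.exp t) (Real.abs_exp t)
  obtain ⟨U', hU', hU'0⟩ := hexp (-Real.exp t) (by rw [abs_neg, Real.abs_exp])
  set V : Set ℝ := {v | Real.exp v ∈ U ∧ -Real.exp v ∈ U'} with hV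
  have hVt : V ∈ 𝓝 t := Filter.inter_mem (Real.continuous_exp.continuousAt hU)
    (Real.continuous_exp.neg.continuousAt hU')
  obtain ⟨W, hWV, hWo, htW⟩ := mem_nhds_iff.mp hVt
  have hnull : (P.map X) {x | x ≠ 0 ∧ Real.log |x| ∈ W} = 0 := by
    refine measure_eq_zero_of_tiltedLaw_eq_zero (α := α) (fun x hx => hx.1)
      (measure_mono_null (fun x hx => ?_) (measure_union_null hU0 hU'0))
    have hxV := hWV hx.2
    simp only [hV, Set.mem_ofPred_eq, Real.exp_log (abs_pos.mpr hx.1)] at hxV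
    rcases lt_or_gt_of_ne hx.1 with h | h
    · right
      simpa [abs_of_neg h] using hxV.2
    · left
      simpa [abs_of_pos h] using hxV.1
  have hpos := (Measure.mem_support_iff_forall t).mp ht W (hWo.mem_nhds htW)
  have hXne : MeasurableSet {ω | X ω ≠ 0} := (hX (measurableSet_singleton 0)).compl
  have hlogm : Measurable fun ω => Real.log |X ω| := measurable_log_abs.comp hX
  have hSm : MeasurableSet {x : ℝ | x ≠ 0 ∧ Real.log |x| ∈ W} :=
    (measurableSet_singleton (0 : ℝ)).compl.inter (measurable_log_abs hWo.measurableSet)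
  rw [condLogLaw, Measure.map_apply hlogm hWo.measurableSet, cond_apply hXne] at hpos
  rw [Measure.map_apply hX hSm] at hnull
  refine hpos.ne' ?_
  rw [show {ω | X ω ≠ 0} ∩ (fun ω => Real.log |X ω|) ⁻¹' W =
    X ⁻¹' {x | x ≠ 0 ∧ Real.log |x| ∈ W} from rfl, hnull, mul_zero]

lemma isArithmetic_condLogLaw_of_ae_abs_eq_one {X : Ω → ℝ} (hX : Measurable X)
    (h : ∀ᵐ ω ∂P, |X ω| = 1) : IsArithmetic (condLogLaw P X) := by
  refine ⟨1, one_ne_zero, Set.Subset.trans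
    (Measure.support_subset_of_isClosed (isClosed_singleton (x := (0 : ℝ))) ?_)
    (Set.singleton_subset_iff.mpr (AddSubgroup.zero_mem _))⟩
  have hlogm : Measurable fun ω => Real.log |X ω| := measurable_log_abs.comp hX
  change ∀ᵐ t ∂(condLogLaw P X), t = 0
  refine (ae_map_iff hlogm.aemeasurable (measurableSet_singleton (0 : ℝ))).mpr ?_
  filter_upwards [cond_absolutelyContinuous.ae_le h] with ω hω
  change Real.log |X ω| = 0
  rw [hω, Real.log_one]

end Main

theorem mainTheorem7 {Ω : Type*} [MeasurableSpace Ω] (P : Measure Ω) [IsProbabilityMeasure P]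
    (X : Ω → ℝ) (hX : Measurable X) (Xs : ℕ → Ω → ℝ) (hXs : ∀ i, Measurable (Xs i))
    (hident : ∀ i, IdentDistrib (Xs i) X P P)
    (hindep : iIndepFun Xs P)
    (α : ℝ) (hα : 0 < α)
    (hmoment : ∫ ω, |X ω| ^ α ∂P = 1)
    (hlog : Integrable (fun ω => |X ω| ^ α * Real.log |X ω|) P)
    (hfix : ∀ x : ℝ, P {ω | X ω * x + 1 = x} < 1)
    (hneg : 0 < P {ω | X ω < 0}) :
    (¬ IsArithmetic (condLogLaw P X) →
      ∃ c : ℝ, 0 < c ∧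
        Tendsto (fun x : ℝ => x ^ α * P.real {ω | (x : EReal) < maxProd Xs ω}) atTop (𝓝 c)) ∧
    (IsArithmetic (condLogLaw P X) → P {ω | |X ω| = 1} < 1 →
      ∃ c c' : ℝ, 0 < c ∧ c < c' ∧
        ∀ᶠ x : ℝ in atTop,
          x ^ α * P.real {ω | (x : EReal) < maxProd Xs ω} ∈ Set.Icc c c') := by
  obtain ⟨μ, hμ⟩ : ∃ μ, μ = P.map X := ⟨_, rfl⟩
  have hμprob : IsProbabilityMeasure μ := hμ ▸ Measure.isProbabilityMeasure_map hX.aemeasurable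
  have hmom : ∫ x, |x| ^ α ∂μ = 1 := by
    rw [hμ, integral_map hX.aemeasurable measurable_abs_rpow.aestronglyMeasurable, hmoment]
  have hlogμ : Integrable (fun x => |x| ^ α * Real.log |x|) μ := by
    rw [hμ]
    exact (integrable_map_measure (measurable_abs_rpow.mul measurable_log_abs).aestronglyMeasurable
      hX.aemeasurable).mpr hlog
  have hν := isProbabilityMeasure_tiltedLaw hmom
  have hν0 : tiltedLaw μ α {0} = 0 := tiltedLaw_singleton_zero hα
  have hi := integrable_log_tiltedLaw hlogμ
  have hνneg : tiltedLaw μ α (Set.Iio 0) ≠ 0 := fun h => by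
    have h1 : μ (Set.Iio 0) = 0 :=
      measure_eq_zero_of_tiltedLaw_eq_zero (fun x (hx : x < 0) => hx.ne) h
    rw [hμ, Measure.map_apply hX measurableSet_Iio] at h1
    exact hneg.ne' h1
  have hae : (∀ᵐ x ∂μ, |x| = 1) → ∀ᵐ ω ∂P, |X ω| = 1 := fun h => by
    rw [hμ] at h
    exact ae_of_ae_map hX.aemeasurable h
  set G : ℝ → ℝ := fun y => |y| ^ α * beyondProb μ y with hG
  have htail : ∀ x : ℝ, 1 ≤ x →
      x ^ α * P.real {ω | (x : EReal) < maxProd Xs ω} = G x := fun x hx => by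
    rw [measureReal_lt_maxProd_eq_beyondProb hμ hXs hident hindep hx, hG]
    simp only [abs_of_pos (one_pos.trans_le hx)]
  -- The lower bound holds whether or not the logarithmic law is arithmetic.
  have hlower : (¬∀ᵐ x ∂μ, |x| = 1) → ∃ c > 0, ∀ x : ℝ, 1 ≤ x → c ≤ G x := fun h1 => by
    obtain ⟨c, hc, hle⟩ := (isRescaledTail_beyondProb hα hmom h1).exists_pos_le hα hν0 hi hνneg
    refine ⟨c, hc, fun x hx => ?_⟩
    have := hle (Real.log x) (Real.log_nonneg hx)
    rwa [Real.exp_log (one_pos.trans_le hx)] at this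
  constructor
  · intro hna
    have h1 : ¬∀ᵐ x ∂μ, |x| = 1 := fun h =>
      hna (isArithmetic_condLogLaw_of_ae_abs_eq_one hX (hae h))
    obtain ⟨ℓ, hℓ⟩ := (isRescaledTail_beyondProb hα hmom h1).exists_tendsto_atTop hα hν0 hi
      (integral_log_tiltedLaw_pos hα hmom hlogμ h1) hνneg fun ⟨a, ha0, ha⟩ =>
        hna ⟨a, ha0, (support_condLogLaw_subset_logSupport hX α).trans (hμ ▸ ha)⟩
    obtain ⟨c, hc, hle⟩ := hlower h1
    refine ⟨ℓ, hc.trans_le (ge_of_tendsto hℓ ?_), hℓ.congr' ?_⟩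
    · filter_upwards [eventually_ge_atTop 1] with x hx using hle x hx
    · filter_upwards [eventually_ge_atTop 1] with x hx using (htail x hx).symm
  · intro _ hlt
    have h1 : ¬∀ᵐ x ∂μ, |x| = 1 := fun h => hlt.ne ((measure_congr
      (eventuallyEq_univ.mpr (hae h))).trans measure_univ)
    obtain ⟨c, hc, hle⟩ := hlower h1
    have hle1 := (isRescaledTail_beyondProb hα hmom h1).le_one
    refine ⟨c, 2, hc, by linarith [hle 1 le_rfl, hle1 1], ?_⟩
    filter_upwards [eventually_ge_atTop 1] with x hx
    rw [htail x hx]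
    exact ⟨hle x hx, (hle1 x).trans one_le_two⟩
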